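/- Let $\mathcal H$ be an infinite-dimensional separable complex Hilbert space. Let $\mathsf U=\mathsf U(\mathcal H)$ be its unitary group with the norm topology, let $\mathsf{PU}=\mathsf U/U(1)$ be the quotient by the unitary scalars, and let $\mathsf U_{\mathcal K}=\mathsf U\cap(1+\mathcal K)$, where $\mathcal K$ is the ideal of compact operators on $\mathcal H$. Regard $\mathsf U$, $\mathsf{PU}$ and $\mathsf U/\mathsf U_{\mathcal K}$ as (real, smooth) Banach Lie groups, with charts near the identity given by the exponential map of their Lie algebras $\mathfrak u$ (the skew-adjoint bounded operators), $\mathfrak u/i\mathbb R$ and $\mathfrak u/(\mathfrak u\cap\mathcal K)$. A smooth real differential form $\eta$ on a Lie group $G$ is called bi-invariant if $L_g^*\eta=\eta=R_g^*\eta$ for all $g\in G$, and primitive if $m^*\eta=\mathrm{pr}_1^*\eta+\mathrm{pr}_2^*\eta$ on $G\times G$, where $m$ is the multiplication. Then: 1. Every smooth bi-invariant 2-form on $\mathsf U$, on $\mathsf{PU}$, or on $\mathsf U/\mathsf U_{\mathcal K}$ is zero. 2. No connection on the principal $U(1)$-bundle $\pi\colon\mathsf U\to\mathsf{PU}$ has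 primitive curvature: if $iA$ is a connection 1-form on $\mathsf U$ (that is, $A$ is a smooth real 1-form on $\mathsf U$, invariant under multiplication by $U(1)$, whose value on the velocity at $t=0$ of each curve $t\mapsto u e^{it}$ is $1$), and $F$ is the curvature, i.e. the smooth 2-form on $\mathsf{PU}$ with $\pi^*F=dA$, then $F$ is not primitive. -/

import Mathlib

open scoped Manifold ContDiff Topology

universe u

/-- Differentiability descends along a surjection `P` and an embedding `ι`. -/
theorem descend_hasFDerivAt {F F' W V : Type u}
    [NormedAddCommGroup F] [NormedSpace ℝ F] [CompleteSpace F]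
    [NormedAddCommGroup F'] [NormedSpace ℝ F'] [CompleteSpace F']
    [NormedAddCommGroup W] [NormedSpace ℝ W] [CompleteSpace W]
    [NormedAddCommGroup V] [NormedSpace ℝ V]
    (P : F →L[ℝ] F') (hP : Function.Surjective P) (ι : W →L[ℝ] V)
    {K : NNReal} (hι : AntilipschitzWith K ι)
    (f : F' → W) (x : F) (L : F →L[ℝ] V) (hL : HasFDerivAt (fun z => ι (f (P z))) L x) :
    ∃ D : F' →L[ℝ] W, HasFDerivAt f D (P x) ∧ L = (ι.comp D).comp P := by
  obtain ⟨C, hC, hs⟩ := P.exists_preimage_norm_le hP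
  choose s hs1 hs2 using hs
  have hK : ∀ w, ‖w‖ ≤ K * ‖ι w‖ := fun w => by
    simpa using hι.le_mul_dist w 0
  have hcl : IsClosed (Set.range ι) := hι.isClosed_range ι.uniformContinuous
  have hline : ∀ v, Filter.Tendsto (fun t : ℝ => t⁻¹ • (ι (f (P (x + t • v))) - ι (f (P x))))
      (𝓝[≠] 0) (𝓝 (L v)) := fun v => by
    have h2 : HasDerivAt (fun t : ℝ => ι (f (P (x + t • v)))) (L v) 0 := by
      have h1 : HasDerivAt (fun t : ℝ => x + t • v) v 0 := by
        simpa using ((hasDerivAt_id (0 : ℝ)).smul_const v).const_add x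
      have := HasFDerivAt.comp_hasDerivAt (f := fun t : ℝ => x + t • v) (0 : ℝ)
        (l := fun z => ι (f (P z))) (l' := L) (by simpa using hL) h1
      simpa [Function.comp_def] using this
    have := hasDerivAt_iff_tendsto_slope.1 h2
    exact this.congr fun t => by simp [slope]
  have hran : ∀ v, L v ∈ Set.range ι := fun v => by
    refine hcl.mem_of_tendsto (hline v) (Filter.Eventually.of_forall fun t => ?_)
    exact ⟨t⁻¹ • (f (P (x + t • v)) - f (P x)), by simp⟩
  have hker : ∀ v, P v = 0 → L v = 0 := fun v hv => by
    refine tendsto_nhds_unique (hline v) ?_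
    simp [hv]
  have hL2 : ∀ v w, P v = P w → L v = L w := fun v w h => by
    have := hker (v - w) (by simp [h])
    simpa [sub_eq_zero] using this
  have hinj : Function.Injective ι := hι.injective
  choose j hj using hran
  let Dl : F' →ₗ[ℝ] W :=
    { toFun := fun y => j (s y)
      map_add' := fun y z => hinj (by
        rw [map_add, hj, hj, hj, ← map_add]; exact hL2 _ _ (by simp [hs1]))
      map_smul' := fun c y => hinj (by
        rw [RingHom.id_apply, map_smul, hj, hj, ← map_smul]; exact hL2 _ _ (by simp [hs1])) }
  let D : F' →L[ℝ] W := Dl.mkContinuous (K * (‖L‖ * C)) fun y => by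
    calc ‖j (s y)‖ ≤ K * ‖ι (j (s y))‖ := hK _
      _ = K * ‖L (s y)‖ := by rw [hj]
      _ ≤ K * (‖L‖ * (C * ‖y‖)) := by
        gcongr
        exact (L.le_opNorm _).trans (by gcongr; exact hs2 y)
      _ = _ := by ring
  have hD : ∀ y, ι (D y) = L (s y) := fun y => hj _
  refine ⟨D, ?_, ?_⟩
  · rw [hasFDerivAt_iff_isLittleO_nhds_zero] at hL ⊢
    have hs0 : Filter.Tendsto s (𝓝 0) (𝓝 0) := by
      rw [tendsto_zero_iff_norm_tendsto_zero]
      refine squeeze_zero (fun _ => norm_nonneg _) hs2 ?_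
      have : Continuous fun y : F' => C * ‖y‖ := by fun_prop
      simpa using this.tendsto 0
    have h1 := hL.comp_tendsto hs0
    have h2 : (s : F' → F) =O[𝓝 0] (fun y => y) :=
      Asymptotics.IsBigO.of_bound C (Filter.Eventually.of_forall hs2)
    have h3 := h1.trans_isBigO h2
    refine Asymptotics.IsBigO.trans_isLittleO ?_ h3
    refine Asymptotics.IsBigO.of_bound K (Filter.Eventually.of_forall fun y => ?_)
    refine (hK _).trans (le_of_eq ?_)
    simp [hD, hs1]
  · ext v
    simp only [ContinuousLinearMap.comp_apply, hD]
    exact hL2 _ _ (hs1 _).symm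

/-- Finite-order smoothness descends along a surjection `P` and an embedding `ι`. -/
theorem descend_contDiffAt_nat {F F' : Type u}
    [NormedAddCommGroup F] [NormedSpace ℝ F] [CompleteSpace F]
    [NormedAddCommGroup F'] [NormedSpace ℝ F'] [CompleteSpace F']
    (P : F →L[ℝ] F') (hP : Function.Surjective P) (x : F) (n : ℕ) :
    ∀ {W V : Type u} [NormedAddCommGroup W] [NormedSpace ℝ W] [CompleteSpace W]
    [NormedAddCommGroup V] [NormedSpace ℝ V]
    (ι : W →L[ℝ] V) {K : NNReal} (_ : AntilipschitzWith K ι) (f : F' → W),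
    ContDiffAt ℝ n (fun z => ι (f (P z))) x → ContDiffAt ℝ n f (P x) := by
  have hmap : Filter.map P (𝓝 x) = 𝓝 (P x) := (P.isOpenMap hP).map_nhds_eq P.continuous.continuousAt
  induction n with
  | zero =>
    intro W V _ _ _ _ _ ι K hι f hf
    rw [Nat.cast_zero, contDiffAt_zero] at hf ⊢
    obtain ⟨u, hu, hc⟩ := hf
    obtain ⟨v, hvu, hvo, hxv⟩ := mem_nhds_iff.1 hu
    refine ⟨P '' v, (P.isOpenMap hP v hvo).mem_nhds ⟨x, hxv, rfl⟩, ?_⟩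
    rintro _ ⟨z, hz, rfl⟩
    refine ContinuousAt.continuousWithinAt ?_
    have h1 : ContinuousAt (fun z => ι (f (P z))) z := (hc.mono hvu).continuousAt (hvo.mem_nhds hz)
    have hind := (hι.isUniformInducing ι.uniformContinuous).isInducing
    have h2 : ContinuousAt (fun z => f (P z)) z := hind.continuousAt_iff.2 h1
    rw [ContinuousAt, ← (P.isOpenMap hP).map_nhds_eq P.continuous.continuousAt]
    exact Filter.tendsto_map'_iff.2 h2
  | succ n ih =>
    intro W V _ _ _ _ _ ι K hι f hf
    rw [Nat.cast_succ, contDiffAt_succ_iff_hasFDerivAt] at hf ⊢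
    obtain ⟨g, ⟨u, hu, hg⟩, hgc⟩ := hf
    have key : ∀ z ∈ u, HasFDerivAt f (fderiv ℝ f (P z)) (P z) ∧
        g z = (ι.comp (fderiv ℝ f (P z))).comp P := fun z hz => by
      obtain ⟨D, h1, h2⟩ := descend_hasFDerivAt P hP ι hι f z (g z) (hg z hz)
      rw [h1.fderiv]
      exact ⟨h1, h2⟩
    refine ⟨fderiv ℝ f, ⟨P '' u, ?_, ?_⟩, ?_⟩
    · rw [← hmap]; exact Filter.image_mem_map hu
    · rintro _ ⟨z, hz, rfl⟩
      exact (key z hz).1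
    · let J : (F' →L[ℝ] W) →L[ℝ] (F →L[ℝ] V) :=
        (ContinuousLinearMap.precomp V P).comp (ContinuousLinearMap.postcomp F' ι)
      obtain ⟨C, hC, hs⟩ := P.exists_preimage_norm_le hP
      have hK : ∀ w, ‖w‖ ≤ K * ‖ι w‖ := fun w => by
        simpa using hι.le_mul_dist w 0
      have hJ : AntilipschitzWith (K * C.toNNReal) J := by
        refine AddMonoidHomClass.antilipschitz_of_bound J fun D => ?_
        refine D.opNorm_le_bound (by positivity) fun y => ?_
        obtain ⟨v, rfl, hv⟩ := hs y
        have hCC : ((K * C.toNNReal : NNReal) : ℝ) = K * C := by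
          simp [Real.coe_toNNReal C hC.le]
        rw [hCC]
        calc ‖D (P v)‖ ≤ K * ‖ι (D (P v))‖ := hK _
          _ = K * ‖(J D) v‖ := rfl
          _ ≤ K * (‖J D‖ * (C * ‖P v‖)) := by
            gcongr
            exact ((J D).le_opNorm _).trans (by gcongr)
          _ = _ := by ring
      refine ih J hJ _ (hgc.congr_of_eventuallyEq ?_)
      filter_upwards [hu] with z hz
      exact ((key z hz).2).symm

/-- Smoothness descends along a surjective continuous linear map between Banach spaces. -/
theorem descend_contDiffAt {F F' W : Type u}
    [NormedAddCommGroup F] [NormedSpace ℝ F] [CompleteSpace F]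
    [NormedAddCommGroup F'] [NormedSpace ℝ F'] [CompleteSpace F']
    [NormedAddCommGroup W] [NormedSpace ℝ W] [CompleteSpace W]
    (P : F →L[ℝ] F') (hP : Function.Surjective P) (x : F) (f : F' → W)
    (hf : ContDiffAt ℝ ∞ (fun z => f (P z)) x) : ContDiffAt ℝ ∞ f (P x) := by
  rw [contDiffAt_infty] at hf ⊢
  intro n
  exact descend_contDiffAt_nat P hP x n (ContinuousLinearMap.id ℝ W)
    (K := 1) AntilipschitzWith.id f (hf n)

/-- A Lipschitz estimate for the exponential series, relative to the quotient map `q` by an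
ideal. -/
theorem norm_exp_sub_exp_le {A B : Type*} [NormedRing A] [NormedAlgebra ℝ A] [CompleteSpace A]
    [NormedAddCommGroup B] [NormedSpace ℝ B] (q : A →L[ℝ] B)
    (hl : ∀ a b, ‖q (a * b)‖ ≤ ‖a‖ * ‖q b‖) (hr : ∀ a b, ‖q (a * b)‖ ≤ ‖q a‖ * ‖b‖)
    {r : ℝ} {x y : A} (hx : ‖x‖ ≤ r) (hy : ‖y‖ ≤ r) :
    ‖q (NormedSpace.exp x - NormedSpace.exp y - (x - y))‖ ≤ (Real.exp r - 1) * ‖q (x - y)‖ := by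
  have hr0 : 0 ≤ r := (norm_nonneg _).trans hx
  have hpow : ∀ n : ℕ, ‖q (x ^ (n + 1) - y ^ (n + 1))‖ ≤ (n + 1) * r ^ n * ‖q (x - y)‖ := by
    intro n
    induction n with
    | zero => simp
    | succ n ih =>
      have e : x ^ (n + 1 + 1) - y ^ (n + 1 + 1) =
          (x ^ (n + 1) - y ^ (n + 1)) * x + y ^ (n + 1) * (x - y) := by
        rw [pow_succ x (n + 1), pow_succ y (n + 1)]; noncomm_ring
      rw [e, map_add]
      have h1 := hr (x ^ (n + 1) - y ^ (n + 1)) x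
      have h2 := hl (y ^ (n + 1)) (x - y)
      have h3 : ‖y ^ (n + 1)‖ ≤ r ^ (n + 1) :=
        (norm_pow_le' y (Nat.succ_pos n)).trans (by gcongr)
      calc _ ≤ _ := norm_add_le _ _
        _ ≤ ((n + 1) * r ^ n * ‖q (x - y)‖) * r + r ^ (n + 1) * ‖q (x - y)‖ :=
          add_le_add (h1.trans (by gcongr)) (h2.trans (by gcongr))
        _ = _ := by push_cast; ring
  have hs : ∀ z : A, HasSum (fun n : ℕ => ((n + 2).factorial : ℝ)⁻¹ • z ^ (n + 2))
      (NormedSpace.exp z - (1 + z)) := fun z => by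
    have := (hasSum_nat_add_iff' 2).2 (NormedSpace.exp_series_hasSum_exp' (𝕂 := ℝ) z)
    simpa [Finset.sum_range_succ] using this
  have hsum := ((hs x).sub (hs y)).mapL q
  have e1 : NormedSpace.exp x - (1 + x) - (NormedSpace.exp y - (1 + y)) =
      NormedSpace.exp x - NormedSpace.exp y - (x - y) := by abel
  rw [e1] at hsum
  have hreal : HasSum (fun n : ℕ => r ^ (n + 1) / ((n + 1).factorial : ℝ)) (Real.exp r - 1) := by
    have h0 : HasSum (fun n : ℕ => r ^ n / (n.factorial : ℝ)) (Real.exp r) := by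
      rw [Real.exp_eq_exp_ℝ]; exact NormedSpace.expSeries_div_hasSum_exp r
    simpa using (hasSum_nat_add_iff' 1).2 h0
  rw [← hsum.tsum_eq]
  refine tsum_of_norm_bounded (hreal.mul_right _) fun n => ?_
  rw [← smul_sub, map_smul, norm_smul]
  have hf : ((n + 2).factorial : ℝ) = (n + 2) * ((n + 1).factorial : ℝ) := by
    rw [Nat.factorial_succ]; push_cast; ring
  have hf0 : (0 : ℝ) < (n + 1).factorial := by exact_mod_cast Nat.factorial_pos _
  have := hpow (n + 1)
  push_cast at this
  calc ‖((n + 2).factorial : ℝ)⁻¹‖ * ‖q (x ^ (n + 2) - y ^ (n + 2))‖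
      ≤ ‖((n + 2).factorial : ℝ)⁻¹‖ * ((n + 1 + 1) * r ^ (n + 1) * ‖q (x - y)‖) := by gcongr
    _ = _ := by
      rw [Real.norm_of_nonneg (by positivity), hf]
      field_simp
      ring

section Log

variable {A : Type u} [CStarAlgebra A]

open NormedSpace selfAdjoint

theorem exp_half_lt_two : Real.exp (1 / 2) - 1 < 1 := by
  have h := Real.exp_one_lt_d9
  have h2 : Real.exp (1 / 2) * Real.exp (1 / 2) = Real.exp 1 := by
    rw [← Real.exp_add]; norm_num
  nlinarith [Real.exp_pos (1 / 2)]

/-- The logarithm of a unitary is smooth near `exp (i x)`, for `x` small. -/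
theorem contDiffAt_argSelfAdjoint {F : Type*} [NormedAddCommGroup F] [NormedSpace ℝ F]
    (w : F → unitary A) (z : F) (hw : ContDiffAt ℝ ∞ (fun t => (w t : A)) z)
    (x : selfAdjoint A) (hx : ‖x‖ < 1 / 2) (hwz : w z = expUnitary x) :
    ContDiffAt ℝ ∞ (fun t => Unitary.argSelfAdjoint (w t)) z := by
  let X : A := Complex.I • (x : A)
  have hX : ‖X‖ < 1 / 2 := by simpa [X, norm_smul] using hx
  have hexp : ContDiffAt ℝ ∞ (exp : A → A) X := (exp_analytic (𝕂 := ℝ) X).contDiffAt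
  have hD : HasFDerivAt (exp : A → A) (fderiv ℝ exp X) X :=
    (hexp.differentiableAt (by simp)).hasFDerivAt
  have hD1 : ‖fderiv ℝ exp X - ContinuousLinearMap.id ℝ A‖ ≤ Real.exp (1 / 2) - 1 := by
    refine (hD.sub (hasFDerivAt_id X)).le_of_lip' (by
      have := Real.add_one_le_exp (1 / 2 : ℝ); linarith) ?_
    filter_upwards [Metric.isOpen_ball.mem_nhds (show X ∈ Metric.ball (0 : A) (1 / 2) by simpa using hX)] with Y hY
    have := norm_exp_sub_exp_le (ContinuousLinearMap.id ℝ A) (fun a b => norm_mul_le a b)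
      (fun a b => norm_mul_le a b) (x := Y) (y := X) (r := 1 / 2)
      (by simpa using (Metric.mem_ball.1 hY).le) hX.le
    convert this using 2
    simp only [Pi.sub_apply, id, ContinuousLinearMap.id_apply]
    · abel_nf
    · simp
  have hunit : IsUnit (fderiv ℝ exp X) := by
    have : ‖(1 : A →L[ℝ] A) - fderiv ℝ exp X‖ < 1 := by
      rw [norm_sub_rev]; exact hD1.trans_lt exp_half_lt_two
    simpa using (Units.oneSub _ this).isUnit
  obtain ⟨U, hU⟩ := hunit
  let e : A ≃L[ℝ] A := ContinuousLinearEquiv.unitsEquiv ℝ A U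
  have hDe : HasFDerivAt (exp : A → A) (e : A →L[ℝ] A) X := by
    rw [show (e : A →L[ℝ] A) = fderiv ℝ exp X from by rw [← hU]; rfl]; exact hD
  have hlog := hexp.to_localInverse hDe (by simp)
  have hleft : ∀ᶠ Y in 𝓝 X, hexp.localInverse hDe (by simp) (exp Y) = Y :=
    (hexp.hasStrictFDerivAt' hDe (by simp)).eventually_left_inverse
  have hpi : ‖x‖ < Real.pi := hx.trans (by linarith [Real.pi_gt_three])
  have hcw : ContinuousAt w z := by
    rw [Topology.IsInducing.subtypeVal.continuousAt_iff]; exact hw.continuousAt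
  have hball : expUnitary x ∈ Metric.ball (1 : unitary A) 2 :=
    (Unitary.openPartialHomeomorph (A := A)).map_target (by simpa using hpi)
  have harg : ContinuousAt (fun t => Unitary.argSelfAdjoint (w t)) z := by
    have : ContinuousAt (Unitary.argSelfAdjoint (A := A)) (w z) := by
      rw [hwz]
      exact Unitary.continuousOn_argSelfAdjoint.continuousAt (Metric.isOpen_ball.mem_nhds hball)
    exact this.comp hcw
  have hargz : Unitary.argSelfAdjoint (w z) = x := by
    rw [hwz]; exact argSelfAdjoint_expUnitary hpi
  have hIarg : Filter.Tendsto (fun t => Complex.I • (Unitary.argSelfAdjoint (w t) : A)) (𝓝 z) (𝓝 X) := by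
    have h1 : ContinuousAt (fun t => Complex.I • (Unitary.argSelfAdjoint (w t) : A)) z :=
      (continuous_subtype_val.continuousAt.comp harg).const_smul _
    have := h1.tendsto
    rwa [hargz] at this
  have hnear : ∀ᶠ t in 𝓝 z, w t ∈ Metric.ball (1 : unitary A) 2 :=
    hcw.eventually (by rw [hwz]; exact Metric.isOpen_ball.mem_nhds hball)
  have hcomp : ContDiffAt ℝ ∞ (fun t => Complex.I • (Unitary.argSelfAdjoint (w t) : A)) z := by
    have hlog' : ContDiffAt ℝ ∞ (hexp.localInverse hDe (by simp)) (w z : A) := by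
      rw [hwz]; exact hlog
    refine (hlog'.comp z hw).congr_of_eventuallyEq ?_
    filter_upwards [hIarg.eventually hleft, hnear] with t h1 h2
    have h3 : expUnitary (Unitary.argSelfAdjoint (w t)) = w t :=
      (Unitary.openPartialHomeomorph (A := A)).left_inv h2
    have h4 : (w t : A) = exp (Complex.I • (Unitary.argSelfAdjoint (w t) : A)) := by
      conv_lhs => rw [← h3]
      rfl
    rw [Function.comp_apply]
    conv_rhs => rw [h4]
    exact h1.symm
  have hval : ContDiffAt ℝ ∞ (fun t => (Unitary.argSelfAdjoint (w t) : A)) z := by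
    have := hcomp.const_smul (-Complex.I)
    simpa [smul_smul] using this
  let part : A →L[ℝ] selfAdjoint A :=
    { selfAdjointPart ℝ (A := A) with
      cont := by
        refine continuous_induced_rng.2 ?_
        show Continuous fun a : A => (selfAdjointPart ℝ a : A)
        simp only [selfAdjointPart_apply_coe]
        fun_prop }
  have hp : ∀ y : selfAdjoint A, part (y : A) = y := fun y =>
    Subtype.ext (IsSelfAdjoint.coe_selfAdjointPart_apply ℝ y.2)
  have hfin := part.contDiff.contDiffAt.comp z hval
  refine hfin.congr_of_eventuallyEq (Filter.Eventually.of_forall fun t => ?_)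
  exact (hp _).symm

end Log

section ExpQuotient

set_option linter.unusedSectionVars false

open selfAdjoint

instance selfAdjoint.instCompleteSpace {A : Type u} [CStarAlgebra A] :
    CompleteSpace (selfAdjoint A) :=
  (isClosed_eq continuous_star continuous_id : IsClosed {a : A | star a = a}).completeSpace_coe

/-- The data that present a topological group `G` as a quotient of the unitary group of a
C⋆-algebra, and a Banach space `E` as the corresponding quotient of its Lie algebra
(identified with the self-adjoint elements by `x ↦ i x`), so that `exp (i x)` descends to a map
`E → G` that is injective near zero. -/
structure ExpQuotient (A : Type u) [CStarAlgebra A] (G : Type u) [Group G] [TopologicalSpace G]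
    (E : Type u) [NormedAddCommGroup E] [NormedSpace ℝ E] where
  proj : unitary A →* G
  proj_quot : IsOpenQuotientMap proj
  lin : selfAdjoint A →L[ℝ] E
  lin_surj : Function.Surjective lin
  proj_exp : ∀ x y, lin x = lin y → proj (expUnitary x) = proj (expUnitary y)
  lin_eq : ∀ x y, ‖x‖ < 1 / 2 → ‖y‖ < 1 / 2 →
    proj (expUnitary x) = proj (expUnitary y) → lin x = lin y

namespace ExpQuotient

variable {A : Type u} [CStarAlgebra A] {G : Type u} [Group G] [TopologicalSpace G]
  {E : Type u} [NormedAddCommGroup E] [NormedSpace ℝ E]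
  (Q : ExpQuotient A G E)

/-- The exponential map `E → G`, `[x] ↦ [exp (i x)]`. -/
noncomputable def expMap (y : E) : G := Q.proj (expUnitary (Function.surjInv Q.lin_surj y))

theorem expMap_lin (x : selfAdjoint A) : Q.expMap (Q.lin x) = Q.proj (expUnitary x) :=
  Q.proj_exp _ _ (Function.surjInv_eq Q.lin_surj _)

theorem injOn_expMap : Set.InjOn Q.expMap (Q.lin '' Metric.ball 0 (1 / 2)) := by
  rintro _ ⟨x, hx, rfl⟩ _ ⟨y, hy, rfl⟩ h
  rw [expMap_lin, expMap_lin] at h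
  exact Q.lin_eq x y (by simpa using hx) (by simpa using hy) h

variable [CompleteSpace E]

theorem continuous_expMap : Continuous Q.expMap := by
  have hq : Topology.IsQuotientMap Q.lin :=
    (Q.lin.isOpenMap Q.lin_surj).isQuotientMap Q.lin.continuous Q.lin_surj
  rw [hq.continuous_iff]
  have : Q.expMap ∘ Q.lin = fun x => Q.proj (expUnitary x) := funext Q.expMap_lin
  rw [this]
  exact Q.proj_quot.continuous.comp continuous_expUnitary

theorem isOpen_image_expUnitary {W : Set (selfAdjoint A)} (hW : IsOpen W)
    (h : W ⊆ Metric.ball 0 (1 / 2)) : IsOpen (expUnitary '' W) := by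
  refine (Unitary.openPartialHomeomorph (A := A)).symm.isOpen_image_of_subset_source hW ?_
  refine h.trans (Metric.ball_subset_ball ?_)
  linarith [Real.pi_gt_three]

theorem isOpen_target : IsOpen (Q.lin '' Metric.ball 0 (1 / 2)) :=
  Q.lin.isOpenMap Q.lin_surj _ Metric.isOpen_ball

/-- The exponential map as a homeomorphism from a neighbourhood of `0` onto its open image. -/
noncomputable def expHomeo : OpenPartialHomeomorph E G :=
  OpenPartialHomeomorph.ofContinuousOpenRestrict
    (Q.injOn_expMap.toPartialEquiv)
    Q.continuous_expMap.continuousOn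
    (by
      intro W hW
      obtain ⟨W', hW', rfl⟩ := hW
      have : (Set.domRestrict (Q.lin '' Metric.ball 0 (1 / 2)) Q.expMap) '' (Subtype.val ⁻¹' W') =
          Q.proj '' (expUnitary '' (Metric.ball 0 (1 / 2) ∩ Q.lin ⁻¹' W')) := by
        ext g
        constructor
        · rintro ⟨⟨_, x, hx, rfl⟩, hy, rfl⟩
          exact ⟨_, ⟨x, ⟨hx, hy⟩, rfl⟩, (Q.expMap_lin x).symm⟩
        · rintro ⟨_, ⟨x, ⟨hx, hy⟩, rfl⟩, rfl⟩
          exact ⟨⟨_, x, hx, rfl⟩, hy, Q.expMap_lin x⟩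
      refine (congrArg IsOpen this).mpr ?_
      refine Q.proj_quot.isOpenMap _ (isOpen_image_expUnitary ?_ Set.inter_subset_left)
      exact Metric.isOpen_ball.inter (hW'.preimage Q.lin.continuous))
    Q.isOpen_target

theorem expHomeo_apply (y : E) : Q.expHomeo y = Q.expMap y := rfl

theorem expHomeo_source : Q.expHomeo.source = Q.lin '' Metric.ball 0 (1 / 2) := rfl

variable [IsTopologicalGroup G]

/-- The chart `h ↦ log (g⁻¹ h)` of `G` around `g`. -/
noncomputable def chart (g : G) : OpenPartialHomeomorph G E :=
  (Homeomorph.mulLeft g⁻¹).toOpenPartialHomeomorph.trans Q.expHomeo.symm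

theorem zero_mem : (0 : E) ∈ Q.expHomeo.source := ⟨0, by simp, by simp⟩

theorem expMap_zero : Q.expMap 0 = 1 := by
  have := Q.expMap_lin 0
  simpa using this

theorem one_mem : (1 : G) ∈ Q.expHomeo.target := by
  have := Q.expHomeo.map_source Q.zero_mem
  rwa [expHomeo_apply, expMap_zero] at this

theorem chart_apply (g h : G) : Q.chart g h = Q.expHomeo.symm (g⁻¹ * h) := rfl

theorem chart_symm_apply (g : G) (y : E) : (Q.chart g).symm y = g * Q.expMap y := by
  simp [chart, expHomeo_apply, Homeomorph.mulLeft_symm]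

theorem mem_chart_source (g h : G) : h ∈ (Q.chart g).source ↔ g⁻¹ * h ∈ Q.expHomeo.target := by
  simp [chart]

theorem mem_chart_target (g : G) (y : E) : y ∈ (Q.chart g).target ↔ y ∈ Q.expHomeo.source := by
  simp [chart]

/-- The atlas of left translates of the exponential chart. -/
@[reducible] noncomputable def chartedSpace : ChartedSpace E G where
  atlas := Set.range Q.chart
  chartAt := Q.chart
  mem_chart_source g := by
    rw [mem_chart_source, inv_mul_cancel]; exact Q.one_mem
  chart_mem_atlas g := ⟨g, rfl⟩

/-- The logarithm of `G` is smooth along maps that lift smoothly to the unitary group. -/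
theorem contDiffAt_log {F : Type u} [NormedAddCommGroup F] [NormedSpace ℝ F]
    (w : F → unitary A) (z : F) (hw : ContDiffAt ℝ ∞ (fun t => (w t : A)) z)
    (hz : Q.proj (w z) ∈ Q.expHomeo.target) :
    ContDiffAt ℝ ∞ (fun t => Q.expHomeo.symm (Q.proj (w t))) z := by
  obtain ⟨x, hx, hxe⟩ : ∃ x : selfAdjoint A, ‖x‖ < 1 / 2 ∧ Q.proj (expUnitary x) = Q.proj (w z) := by
    have h1 := Q.expHomeo.map_target hz
    obtain ⟨x, hx, h2⟩ := (Q.expHomeo_source ▸ h1 : _ ∈ Q.lin '' Metric.ball 0 (1 / 2))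
    refine ⟨x, by simpa using hx, ?_⟩
    rw [← Q.expMap_lin, h2, ← expHomeo_apply, Q.expHomeo.right_inv hz]
  let n : unitary A := (w z)⁻¹ * expUnitary x
  have hn : Q.proj n = 1 := by simp [n, hxe]
  have hw' : ContDiffAt ℝ ∞ (fun t => ((w t * n : unitary A) : A)) z := by
    simpa using hw.mul contDiffAt_const
  have hz' : w z * n = expUnitary x := by simp [n]
  have hlog := contDiffAt_argSelfAdjoint (fun t => w t * n) z hw' x hx hz'
  have hpi : ‖x‖ < Real.pi := hx.trans (by linarith [Real.pi_gt_three])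
  have hball : expUnitary x ∈ Metric.ball (1 : unitary A) 2 :=
    (Unitary.openPartialHomeomorph (A := A)).map_target (by simpa using hpi)
  have hcw : ContinuousAt (fun t => w t * n) z := by
    rw [Topology.IsInducing.subtypeVal.continuousAt_iff]; exact hw'.continuousAt
  have hnear : ∀ᶠ t in 𝓝 z, w t * n ∈ Metric.ball (1 : unitary A) 2 :=
    hcw.eventually (by simp only [hz']; exact Metric.isOpen_ball.mem_nhds hball)
  have hsmall : ∀ᶠ t in 𝓝 z, Unitary.argSelfAdjoint (w t * n) ∈ Metric.ball (0 : selfAdjoint A) (1 / 2) := by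
    refine hlog.continuousAt.eventually (Metric.isOpen_ball.mem_nhds ?_)
    simp only [hz', argSelfAdjoint_expUnitary hpi]
    simpa using hx
  refine (Q.lin.contDiff.contDiffAt.comp z hlog).congr_of_eventuallyEq ?_
  filter_upwards [hnear, hsmall] with t h1 h2
  have h3 : expUnitary (Unitary.argSelfAdjoint (w t * n)) = w t * n :=
    (Unitary.openPartialHomeomorph (A := A)).left_inv h1
  have h4 : Q.proj (w t) = Q.expHomeo (Q.lin (Unitary.argSelfAdjoint (w t * n))) := by
    rw [expHomeo_apply, expMap_lin, h3, map_mul, hn, mul_one]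
  rw [h4, Q.expHomeo.left_inv (by rw [expHomeo_source]; exact ⟨_, h2, rfl⟩)]
  rfl

theorem contDiff_coe_expUnitary :
    ContDiff ℝ ∞ (fun x : selfAdjoint A => ((expUnitary x : unitary A) : A)) := by
  rw [contDiff_iff_contDiffAt]
  intro x
  have h1 : ContDiffAt ℝ ∞ (NormedSpace.exp : A → A) (Complex.I • (x : A)) :=
    (NormedSpace.exp_analytic (𝕂 := ℝ) _).contDiffAt
  let L : selfAdjoint A →L[ℝ] A :=
    { toFun := fun x => Complex.I • (x : A)
      map_add' := fun a b => by simp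
      map_smul' := fun c a => smul_comm Complex.I c (a : A)
      cont := by fun_prop }
  exact ContDiffAt.comp (f := L) (g := NormedSpace.exp) x h1 L.contDiff.contDiffAt

theorem contDiffAt_chart_aux (g h : G) (y : E)
    (hy : h * Q.expMap y ∈ (Q.chart g).source) :
    ContDiffAt ℝ ∞ (fun t => Q.chart g (h * Q.expMap t)) y := by
  obtain ⟨x, rfl⟩ := Q.lin_surj y
  obtain ⟨a, ha⟩ := Q.proj_quot.surjective (g⁻¹ * h)
  refine descend_contDiffAt Q.lin Q.lin_surj x _ ?_
  have hw : ∀ t, Q.chart g (h * Q.expMap (Q.lin t)) =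
      Q.expHomeo.symm (Q.proj (a * expUnitary t)) := fun t => by
    rw [chart_apply, map_mul, ha, expMap_lin, mul_assoc]
  simp only [hw]
  refine Q.contDiffAt_log (fun t => a * expUnitary t) x ?_ ?_
  · simpa using contDiffAt_const.mul (contDiff_coe_expUnitary (A := A)).contDiffAt
  · rw [mem_chart_source, expMap_lin, ← mul_assoc, ← ha, ← map_mul] at hy
    exact hy

theorem isManifold : letI := Q.chartedSpace; IsManifold 𝓘(ℝ, E) ∞ G := by
  let _ := Q.chartedSpace
  refine isManifold_of_contDiffOn 𝓘(ℝ, E) ∞ G ?_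
  rintro _ _ ⟨h, rfl⟩ ⟨g, rfl⟩
  intro y hy
  refine ContDiffAt.contDiffWithinAt ?_
  have hy' : (Q.chart h).symm y ∈ (Q.chart g).source := by
    have := hy.1
    simp only [modelWithCornersSelf_coe_symm, Set.preimage_id_eq, id_eq,
      OpenPartialHomeomorph.trans_source, Set.mem_inter_iff, Set.mem_preimage] at this
    exact this.2
  rw [chart_symm_apply] at hy'
  refine (Q.contDiffAt_chart_aux g h y hy').congr_of_eventuallyEq
    (Filter.Eventually.of_forall fun t => ?_)
  simp [chart_symm_apply]

theorem lieGroup : letI := Q.chartedSpace; LieGroup 𝓘(ℝ, E) ∞ G := by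
  let _ := Q.chartedSpace
  have := Q.isManifold
  have hsymm0 : Q.expHomeo.symm 1 = 0 := by
    rw [← Q.expMap_zero, ← expHomeo_apply, Q.expHomeo.left_inv Q.zero_mem]
  have hchart : ∀ g, chartAt E g = Q.chart g := fun _ => rfl
  refine { contMDiff_mul := ?_, contMDiff_inv := ?_ }
  · rintro ⟨g, h⟩
    rw [contMDiffAt_iff]
    refine ⟨continuous_mul.continuousAt, ?_⟩
    refine ContDiffAt.contDiffWithinAt ?_
    have e0 : (extChartAt (𝓘(ℝ, E).prod 𝓘(ℝ, E)) (g, h)) (g, h) = ((0, 0) : E × E) := by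
      simp [hchart, chart_apply, hsymm0]
    rw [e0]
    obtain ⟨a, ha⟩ := Q.proj_quot.surjective g
    obtain ⟨b, hb⟩ := Q.proj_quot.surjective h
    let P : (selfAdjoint A × selfAdjoint A) →L[ℝ] E × E := Q.lin.prodMap Q.lin
    have hP : Function.Surjective P := Q.lin_surj.prodMap Q.lin_surj
    have hP0 : P 0 = ((0, 0) : E × E) := map_zero P
    rw [← hP0]
    refine descend_contDiffAt P hP 0 _ ?_
    let w : selfAdjoint A × selfAdjoint A → unitary A := fun t =>
      (a * b)⁻¹ * (a * expUnitary t.1 * (b * expUnitary t.2))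
    have hw : ContDiffAt ℝ ∞ (fun t => (w t : A)) 0 := by
      have h1 : ContDiff ℝ ∞ (fun t : selfAdjoint A × selfAdjoint A =>
          ((expUnitary t.1 : unitary A) : A)) := contDiff_coe_expUnitary.comp contDiff_fst
      have h2 : ContDiff ℝ ∞ (fun t : selfAdjoint A × selfAdjoint A =>
          ((expUnitary t.2 : unitary A) : A)) := contDiff_coe_expUnitary.comp contDiff_snd
      have h3 : ContDiff ℝ ∞ (fun t => (w t : A)) :=
        contDiff_const.mul ((contDiff_const.mul h1).mul (contDiff_const.mul h2))
      exact h3.contDiffAt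
    have hw0 : Q.proj (w 0) ∈ Q.expHomeo.target := by
      have : w 0 = 1 := by simp [w]
      rw [this, map_one]; exact Q.one_mem
    refine (Q.contDiffAt_log w 0 hw hw0).congr_of_eventuallyEq
      (Filter.Eventually.of_forall fun t => ?_)
    have hs : (extChartAt (𝓘(ℝ, E).prod 𝓘(ℝ, E)) (g, h)).symm (P t) =
        (g * Q.expMap (Q.lin t.1), h * Q.expMap (Q.lin t.2)) :=
      Prod.ext (Q.chart_symm_apply g _) (Q.chart_symm_apply h _)
    have he : ∀ k, extChartAt 𝓘(ℝ, E) (g * h) k = Q.expHomeo.symm ((g * h)⁻¹ * k) := fun _ => rfl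
    simp only [Function.comp_apply, hs, he, w, expMap_lin, map_mul, map_inv, ha, hb]
  · intro g
    rw [contMDiffAt_iff]
    refine ⟨continuous_inv.continuousAt, ?_⟩
    refine ContDiffAt.contDiffWithinAt ?_
    have e0 : (extChartAt 𝓘(ℝ, E) g) g = (0 : E) := by
      simp [hchart, chart_apply, hsymm0]
    rw [e0]
    obtain ⟨a, ha⟩ := Q.proj_quot.surjective g
    rw [← map_zero Q.lin]
    refine descend_contDiffAt Q.lin Q.lin_surj 0 _ ?_
    let w : selfAdjoint A → unitary A := fun t => a * (a * expUnitary t)⁻¹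
    have hw : ContDiffAt ℝ ∞ (fun t => (w t : A)) 0 := by
      have h3 : ContDiff ℝ ∞ (fun t => (w t : A)) := by
        have h4 : ContDiff ℝ ∞ (fun t : selfAdjoint A => (a : A) * star ((a : A) * (expUnitary t : unitary A))) :=
          contDiff_const.mul (((starL' ℝ : A ≃L[ℝ] A) : A →L[ℝ] A).contDiff.comp
            (contDiff_const.mul contDiff_coe_expUnitary))
        exact h4
      exact h3.contDiffAt
    have hw0 : Q.proj (w 0) ∈ Q.expHomeo.target := by
      have : w 0 = 1 := by simp [w]
      rw [this, map_one]; exact Q.one_mem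
    refine (Q.contDiffAt_log w 0 hw hw0).congr_of_eventuallyEq
      (Filter.Eventually.of_forall fun t => ?_)
    have hs : (extChartAt 𝓘(ℝ, E) g).symm (Q.lin t) = g * Q.expMap (Q.lin t) :=
      Q.chart_symm_apply g _
    have he : ∀ k, extChartAt 𝓘(ℝ, E) g⁻¹ k = Q.expHomeo.symm (g⁻¹⁻¹ * k) := fun _ => rfl
    simp only [Function.comp_apply, hs, he, w, expMap_lin, map_mul, map_inv, ha, inv_inv]

end ExpQuotient

end ExpQuotient

section Groups

open selfAdjoint

section Algebra

variable (A : Type u) [CStarAlgebra A]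

/-- The inclusion of the circle group `U(1)` into the unitary group as the scalars. -/
noncomputable def scalarUnitary : Circle →* unitary A where
  toFun z := ⟨(z : ℂ) • (1 : A), by
    rw [Unitary.mem_iff]
    have h1 : star (z : ℂ) * (z : ℂ) = 1 := by
      have := Circle.normSq_coe z
      rw [Complex.star_def, ← Complex.normSq_eq_conj_mul_self, this, Complex.ofReal_one]
    constructor
    · rw [star_smul, star_one, smul_mul_smul_comm, mul_one, h1, one_smul]
    · rw [star_smul, star_one, smul_mul_smul_comm, mul_one, mul_comm, h1, one_smul]⟩
  map_one' := by ext1; simp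
  map_mul' z w := by ext1; simp [smul_smul, mul_comm]

/-- The subgroup `U(1)` of unitary scalars. -/
noncomputable def scalarSubgroup : Subgroup (unitary A) := (scalarUnitary A).range

theorem scalarUnitary_comm (z : Circle) (u : unitary A) :
    u * scalarUnitary A z = scalarUnitary A z * u := by
  ext1; simp [scalarUnitary]

instance : (scalarSubgroup A).Normal where
  conj_mem := by
    rintro _ ⟨z, rfl⟩ g
    rw [scalarUnitary_comm, mul_inv_cancel_right]
    exact ⟨z, rfl⟩

/-- The real multiples of `1`, which correspond to the Lie algebra of `U(1)`. -/
noncomputable def scalarSubmodule : Submodule ℝ (selfAdjoint A) := Submodule.span ℝ {1}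

instance : IsClosed (scalarSubmodule A : Set (selfAdjoint A)) := by
  have : FiniteDimensional ℝ (scalarSubmodule A) :=
    FiniteDimensional.span_of_finite ℝ (Set.finite_singleton _)
  exact (scalarSubmodule A).closed_of_finiteDimensional

/-- The unitary group as a quotient of itself. -/
noncomputable def unitaryExp : ExpQuotient A (unitary A) (selfAdjoint A) where
  proj := MonoidHom.id _
  proj_quot := IsOpenQuotientMap.id
  lin := ContinuousLinearMap.id ℝ _
  lin_surj := Function.surjective_id
  proj_exp x y h := by rw [show x = y from h]
  lin_eq x y hx hy h := by
    have hpi := Real.pi_gt_three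
    have h1 := argSelfAdjoint_expUnitary (x := x) (hx.trans (by linarith))
    have h2 := argSelfAdjoint_expUnitary (x := y) (hy.trans (by linarith))
    rw [← h1, ← h2, show expUnitary x = expUnitary y from h]

theorem expUnitary_add_scalar (x : selfAdjoint A) (t : ℝ) :
    expUnitary (x + t • 1) = scalarUnitary A (Circle.exp t) * expUnitary x := by
  have hc : Commute ((t • (1 : selfAdjoint A) : selfAdjoint A) : A) (x : A) := by
    show _ * _ = _ * _
    simp
  rw [add_comm, hc.expUnitary_add]
  congr 1
  ext1
  simp only [expUnitary_coe, scalarUnitary, MonoidHom.coe_mk, OneHom.coe_mk, Circle.coe_exp]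
  have : Complex.I • ((t • (1 : selfAdjoint A) : selfAdjoint A) : A) =
      algebraMap ℂ A (t * Complex.I) := by
    rw [Algebra.algebraMap_eq_smul_one]
    simp [mul_comm, mul_smul]
  rw [this, ← NormedSpace.algebraMap_exp_comm, ← Complex.exp_eq_exp_ℂ,
    Algebra.algebraMap_eq_smul_one]

theorem norm_expUnitary_sub_le (x y : selfAdjoint A) (hx : ‖x‖ < 1 / 2) (hy : ‖y‖ < 1 / 2) :
    ‖((expUnitary x : unitary A) : A) - (expUnitary y : unitary A)‖ < 1.65 := by
  have h := norm_exp_sub_exp_le (ContinuousLinearMap.id ℝ A) (fun a b => norm_mul_le a b)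
      (fun a b => norm_mul_le a b) (x := Complex.I • (x : A)) (y := Complex.I • (y : A))
      (r := 1 / 2) (by simpa [norm_smul] using hx.le) (by simpa [norm_smul] using hy.le)
  simp only [ContinuousLinearMap.id_apply] at h
  have h2 : ‖Complex.I • (x : A) - Complex.I • (y : A)‖ < 1 := by
    rw [← smul_sub, norm_smul, Complex.norm_I, one_mul]
    have h3 := norm_sub_le (x : A) (y : A)
    have hx' : ‖(x : A)‖ < 1 / 2 := hx
    have hy' : ‖(y : A)‖ < 1 / 2 := hy
    linarith
  have h4 : Real.exp (1 / 2) < 1.65 := by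
    have h := Real.exp_one_lt_d9
    have h2 : Real.exp (1 / 2) * Real.exp (1 / 2) = Real.exp 1 := by
      rw [← Real.exp_add]; norm_num
    nlinarith [Real.exp_pos (1 / 2)]
  rw [expUnitary_coe, expUnitary_coe]
  have h5 := norm_le_norm_add_norm_sub' (NormedSpace.exp (Complex.I • (x : A)) -
    NormedSpace.exp (Complex.I • (y : A))) (Complex.I • (x : A) - Complex.I • (y : A))
  have h6 : 0 ≤ Real.exp (1 / 2) - 1 := by
    have := Real.add_one_le_exp (1 / 2 : ℝ); linarith
  nlinarith [norm_nonneg (Complex.I • (x : A) - Complex.I • (y : A))]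

/-- The projective unitary group as a quotient of the unitary group. -/
noncomputable def projectiveExp :
    ExpQuotient A (unitary A ⧸ scalarSubgroup A) (selfAdjoint A ⧸ scalarSubmodule A) where
  proj := QuotientGroup.mk' _
  proj_quot := QuotientGroup.isOpenQuotientMap_mk
  lin := (scalarSubmodule A).mkQL
  lin_surj := Submodule.mkQ_surjective _
  proj_exp x y h := by
    have h1 : y - x ∈ scalarSubmodule A := by
      rw [← Submodule.Quotient.mk_eq_zero, Submodule.Quotient.mk_sub, sub_eq_zero]
      exact h.symm
    obtain ⟨t, ht⟩ := Submodule.mem_span_singleton.1 h1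
    have h2 : y = x + t • 1 := by rw [ht]; abel
    refine QuotientGroup.eq.2 ?_
    rw [h2, expUnitary_add_scalar, ← scalarUnitary_comm, inv_mul_cancel_left]
    exact ⟨_, rfl⟩
  lin_eq x y hx hy h := by
    obtain ⟨z, hz⟩ : (expUnitary x)⁻¹ * expUnitary y ∈ scalarSubgroup A := QuotientGroup.eq.1 h
    rcases subsingleton_or_nontrivial A with hA | hA
    · exact congrArg _ (Subsingleton.elim x y)
    obtain ⟨t, ht, rfl⟩ : ∃ t : ℝ, |t| ≤ Real.pi ∧ Circle.exp t = z :=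
      ⟨Complex.arg z, Complex.abs_arg_le_pi _, Circle.exp_arg z⟩
    have hpi := Real.pi_gt_three
    have hy' : expUnitary y = expUnitary (x + t • 1) := by
      rw [expUnitary_add_scalar, ← scalarUnitary_comm, hz, mul_inv_cancel_left]
    have hn := norm_expUnitary_sub_le A x y hx hy
    have hd : ‖((expUnitary x : unitary A) : A) - (expUnitary y : unitary A)‖ =
        ‖2 * Real.sin (t / 2)‖ := by
      rw [← Complex.norm_exp_I_mul_ofReal_sub_one, norm_sub_rev, hy', expUnitary_add_scalar]
      have : ((scalarUnitary A (Circle.exp t) * expUnitary x : unitary A) : A) -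
          (expUnitary x : unitary A) =
          (Complex.exp (Complex.I * t) - 1) • ((expUnitary x : unitary A) : A) := by
        rw [Submonoid.coe_mul, sub_smul, one_smul, mul_comm Complex.I]
        simp [scalarUnitary]
      rw [this, norm_smul, CStarRing.norm_coe_unitary, mul_one]
    have ht2 : |t / 2| ≤ Real.pi / 2 := by
      rw [abs_div, abs_two]; linarith
    have hs := Real.mul_abs_le_abs_sin ht2
    have htb : |t| < 1.65 / 2 * Real.pi := by
      rw [hd, norm_mul, Real.norm_eq_abs, Real.norm_eq_abs, abs_two] at hn
      rw [abs_div, abs_two] at hs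
      have : 2 / Real.pi * (|t| / 2) = |t| / Real.pi := by field_simp
      rw [this] at hs
      have h3 : |t| / Real.pi < 1.65 / 2 := by linarith
      rwa [div_lt_iff₀ Real.pi_pos] at h3
    have hone : ‖t • (1 : selfAdjoint A)‖ = |t| := by
      rw [norm_smul, Real.norm_eq_abs]
      have : ‖(1 : selfAdjoint A)‖ = 1 := CStarRing.norm_one (E := A)
      rw [this, mul_one]
    have hlt : ‖x + t • (1 : selfAdjoint A)‖ < Real.pi := by
      refine (norm_add_le _ _).trans_lt ?_
      rw [hone]; linarith
    have h1 := argSelfAdjoint_expUnitary (x := x + t • (1 : selfAdjoint A)) hlt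
    have h2 := argSelfAdjoint_expUnitary (x := y) (hy.trans (by linarith))
    have hxy : y = x + t • 1 := by rw [← h1, ← h2, hy']
    refine ((Submodule.Quotient.eq _).2 ?_)
    rw [hxy]
    refine Submodule.mem_span_singleton.2 ⟨-t, ?_⟩
    rw [neg_smul]; abel

end Algebra

end Groups

section Hilbert

open selfAdjoint

/-- The C⋆-algebra `B(H)` of bounded operators on a Hilbert space. -/
def BddOp (H : Type u) [NormedAddCommGroup H] [InnerProductSpace ℂ H] [CompleteSpace H] : Type u :=
  H →L[ℂ] H

variable (H : Type u) [NormedAddCommGroup H] [InnerProductSpace ℂ H] [CompleteSpace H]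

noncomputable instance : CStarAlgebra (BddOp H) := inferInstanceAs (CStarAlgebra (H →L[ℂ] H))

/-- The norm-closed ideal `K` of compact operators in `B(H)`. -/
noncomputable def compactIdeal : Submodule ℂ (BddOp H) where
  carrier := {a | IsCompactOperator (show H →L[ℂ] H from a)}
  zero_mem' := isCompactOperator_zero
  add_mem' := fun ha hb => IsCompactOperator.add ha hb
  smul_mem' := fun c _ ha => IsCompactOperator.smul ha c

variable {H}

theorem mul_mem_compactIdeal_left (a : BddOp H) {b : BddOp H} (hb : b ∈ compactIdeal H) :
    a * b ∈ compactIdeal H :=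
  IsCompactOperator.clm_comp (show IsCompactOperator (show H →L[ℂ] H from b) from hb)
    (show H →L[ℂ] H from a)

theorem mul_mem_compactIdeal_right {a : BddOp H} (b : BddOp H) (ha : a ∈ compactIdeal H) :
    a * b ∈ compactIdeal H :=
  IsCompactOperator.comp_clm (show IsCompactOperator (show H →L[ℂ] H from a) from ha)
    (show H →L[ℂ] H from b)

variable (H)

theorem isClosed_compactIdeal : IsClosed (compactIdeal H : Set (BddOp H)) :=
  isClosed_setOfPred_isCompactOperator (σ₁₂ := RingHom.id ℂ) (M₁ := H) (M₂ := H)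

/-- The subgroup `U_K = U ∩ (1 + K)` of unitary operators that differ from the identity by a
compact operator. -/
noncomputable def compactSubgroup : Subgroup (unitary (BddOp H)) where
  carrier := {u | (u : BddOp H) - 1 ∈ compactIdeal H}
  one_mem' := by
    show ((1 : unitary (BddOp H)) : BddOp H) - 1 ∈ compactIdeal H
    rw [Submonoid.coe_one, sub_self]; exact zero_mem _
  mul_mem' := by
    intro a b (ha : (a : BddOp H) - 1 ∈ compactIdeal H) (hb : (b : BddOp H) - 1 ∈ compactIdeal H)
    show ((a * b : unitary (BddOp H)) : BddOp H) - 1 ∈ compactIdeal H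
    have e : ((a * b : unitary (BddOp H)) : BddOp H) - 1 =
        ((a : BddOp H) - 1) * (b : BddOp H) + ((b : BddOp H) - 1) := by
      rw [Submonoid.coe_mul]; noncomm_ring
    rw [e]; exact add_mem (mul_mem_compactIdeal_right _ ha) hb
  inv_mem' := by
    intro a (ha : (a : BddOp H) - 1 ∈ compactIdeal H)
    show ((a⁻¹ : unitary (BddOp H)) : BddOp H) - 1 ∈ compactIdeal H
    have e : ((a⁻¹ : unitary (BddOp H)) : BddOp H) - 1 =
        -(((a⁻¹ : unitary (BddOp H)) : BddOp H) * ((a : BddOp H) - 1)) := by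
      have : ((a⁻¹ : unitary (BddOp H)) : BddOp H) * (a : BddOp H) = 1 := by
        rw [← Submonoid.coe_mul, inv_mul_cancel, Submonoid.coe_one]
      rw [mul_sub, this, mul_one, neg_sub]
    rw [e]; exact neg_mem (mul_mem_compactIdeal_left _ ha)

theorem mem_compactSubgroup_iff (u : unitary (BddOp H)) :
    u ∈ compactSubgroup H ↔ (u : BddOp H) - 1 ∈ compactIdeal H := Iff.rfl

instance : (compactSubgroup H).Normal where
  conj_mem := by
    intro a ha g
    rw [mem_compactSubgroup_iff] at ha ⊢
    have e : ((g * a * g⁻¹ : unitary (BddOp H)) : BddOp H) - 1 =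
        ((g : BddOp H) * ((a : BddOp H) - 1)) * ((g⁻¹ : unitary (BddOp H)) : BddOp H) := by
      have : (g : BddOp H) * ((g⁻¹ : unitary (BddOp H)) : BddOp H) = 1 := by
        rw [← Submonoid.coe_mul, mul_inv_cancel, Submonoid.coe_one]
      rw [mul_sub, sub_mul, mul_one, this, Submonoid.coe_mul, Submonoid.coe_mul]
    rw [e]; exact mul_mem_compactIdeal_right _ (mul_mem_compactIdeal_left _ ha)

theorem inv_mul_mem_compactSubgroup (u v : unitary (BddOp H)) :
    u⁻¹ * v ∈ compactSubgroup H ↔ (u : BddOp H) - (v : BddOp H) ∈ compactIdeal H := by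
  rw [mem_compactSubgroup_iff]
  have hu : (u : BddOp H) * ((u⁻¹ : unitary (BddOp H)) : BddOp H) = 1 := by
    rw [← Submonoid.coe_mul, mul_inv_cancel, Submonoid.coe_one]
  have hu' : ((u⁻¹ : unitary (BddOp H)) : BddOp H) * (u : BddOp H) = 1 := by
    rw [← Submonoid.coe_mul, inv_mul_cancel, Submonoid.coe_one]
  constructor
  · intro h
    have e : (u : BddOp H) - (v : BddOp H) =
        -((u : BddOp H) * (((u⁻¹ * v : unitary (BddOp H)) : BddOp H) - 1)) := by
      rw [Submonoid.coe_mul, mul_sub, ← mul_assoc, hu, one_mul, mul_one, neg_sub]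
    rw [e]; exact neg_mem (mul_mem_compactIdeal_left _ h)
  · intro h
    have e : ((u⁻¹ * v : unitary (BddOp H)) : BddOp H) - 1 =
        -(((u⁻¹ : unitary (BddOp H)) : BddOp H) * ((u : BddOp H) - (v : BddOp H))) := by
      rw [mul_sub, hu', neg_sub, Submonoid.coe_mul]
    rw [e]; exact neg_mem (mul_mem_compactIdeal_left _ h)

/-- The compact self-adjoint operators, which correspond to the Lie algebra of `U_K`. -/
noncomputable def compactSubmodule : Submodule ℝ (selfAdjoint (BddOp H)) where
  carrier := {x | (x : BddOp H) ∈ compactIdeal H}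
  zero_mem' := zero_mem (compactIdeal H)
  add_mem' := by
    intro a b (ha : (a : BddOp H) ∈ compactIdeal H) (hb : (b : BddOp H) ∈ compactIdeal H)
    show ((a + b : selfAdjoint (BddOp H)) : BddOp H) ∈ compactIdeal H
    rw [AddSubgroup.coe_add]; exact add_mem ha hb
  smul_mem' := fun c _ ha => ((compactIdeal H).restrictScalars ℝ).smul_mem c ha

instance : IsClosed (compactSubmodule H : Set (selfAdjoint (BddOp H))) :=
  (isClosed_compactIdeal H).preimage continuous_subtype_val

theorem compactIdeal_estimate (x y : selfAdjoint (BddOp H)) {r : ℝ} (hx : ‖x‖ ≤ r)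
    (hy : ‖y‖ ≤ r) :
    ‖(compactIdeal H).mkQ ((expUnitary x : BddOp H) - (expUnitary y : BddOp H) -
      Complex.I • ((x : BddOp H) - y))‖ ≤
      (Real.exp r - 1) * ‖(compactIdeal H).mkQ (Complex.I • ((x : BddOp H) - y))‖ := by
  have : IsClosed (compactIdeal H : Set (BddOp H)) := isClosed_compactIdeal H
  have h := norm_exp_sub_exp_le ((compactIdeal H).mkQL.restrictScalars ℝ)
    (x := Complex.I • (x : BddOp H))
    (y := Complex.I • (y : BddOp H)) (r := r) ?_ ?_
    (by rw [norm_smul, Complex.norm_I, one_mul]; exact hx)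
    (by rw [norm_smul, Complex.norm_I, one_mul]; exact hy)
  · rw [← smul_sub] at h; exact h
  · intro a b
    refine le_of_forall_pos_le_add fun ε hε => ?_
    obtain ⟨m, hm, hm2⟩ := Submodule.Quotient.norm_mk_lt
      ((compactIdeal H).mkQ b) (ε := ε / (‖a‖ + 1)) (by positivity)
    have h1 : (compactIdeal H).mkQL (a * b) = (compactIdeal H).mkQ (a * m) := by
      refine ((Submodule.Quotient.eq _).2 ?_)
      have h2 : b - m ∈ compactIdeal H := (Submodule.Quotient.eq _).1 hm.symm
      rw [← mul_sub]
      exact mul_mem_compactIdeal_left _ h2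
    show ‖(compactIdeal H).mkQL (a * b)‖ ≤ ‖a‖ * ‖(compactIdeal H).mkQ b‖ + ε
    rw [h1]
    calc _ ≤ ‖a * m‖ := Submodule.Quotient.norm_mk_le _ _
      _ ≤ ‖a‖ * ‖m‖ := norm_mul_le _ _
      _ ≤ ‖a‖ * (‖(compactIdeal H).mkQ b‖ + ε / (‖a‖ + 1)) := by gcongr
      _ = ‖a‖ * ‖(compactIdeal H).mkQ b‖ + ‖a‖ / (‖a‖ + 1) * ε := by ring
      _ ≤ ‖a‖ * ‖(compactIdeal H).mkQ b‖ + 1 * ε := by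
        gcongr
        rw [div_le_one (by positivity)]; linarith
      _ = _ := by rw [one_mul]
  · intro a b
    refine le_of_forall_pos_le_add fun ε hε => ?_
    obtain ⟨m, hm, hm2⟩ := Submodule.Quotient.norm_mk_lt
      ((compactIdeal H).mkQ a) (ε := ε / (‖b‖ + 1)) (by positivity)
    have h1 : (compactIdeal H).mkQL (a * b) = (compactIdeal H).mkQ (m * b) := by
      refine ((Submodule.Quotient.eq _).2 ?_)
      have h2 : a - m ∈ compactIdeal H := (Submodule.Quotient.eq _).1 hm.symm
      rw [← sub_mul]
      exact mul_mem_compactIdeal_right _ h2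
    show ‖(compactIdeal H).mkQL (a * b)‖ ≤ ‖(compactIdeal H).mkQ a‖ * ‖b‖ + ε
    rw [h1]
    calc _ ≤ ‖m * b‖ := Submodule.Quotient.norm_mk_le _ _
      _ ≤ ‖m‖ * ‖b‖ := norm_mul_le _ _
      _ ≤ (‖(compactIdeal H).mkQ a‖ + ε / (‖b‖ + 1)) * ‖b‖ := by gcongr
      _ = ‖(compactIdeal H).mkQ a‖ * ‖b‖ + ‖b‖ / (‖b‖ + 1) * ε := by ring
      _ ≤ ‖(compactIdeal H).mkQ a‖ * ‖b‖ + 1 * ε := by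
        gcongr
        rw [div_le_one (by positivity)]; linarith
      _ = _ := by rw [one_mul]

theorem norm_compactIdeal_eq_zero (a : BddOp H) :
    ‖(compactIdeal H).mkQ a‖ = 0 ↔ a ∈ compactIdeal H := by
  have : IsClosed (compactIdeal H : Set (BddOp H)) := isClosed_compactIdeal H
  rw [norm_eq_zero]
  exact Submodule.Quotient.mk_eq_zero _

theorem I_smul_mem_compactIdeal (a : BddOp H) :
    Complex.I • a ∈ compactIdeal H ↔ a ∈ compactIdeal H :=
  (compactIdeal H).smul_mem_iff Complex.I_ne_zero

/-- `U(H) / U_K` as a quotient of `U(H)`. -/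
noncomputable def calkinExp : ExpQuotient (BddOp H) (unitary (BddOp H) ⧸ compactSubgroup H)
    (selfAdjoint (BddOp H) ⧸ compactSubmodule H) where
  proj := QuotientGroup.mk' _
  proj_quot := QuotientGroup.isOpenQuotientMap_mk
  lin := (compactSubmodule H).mkQL
  lin_surj := Submodule.mkQ_surjective _
  proj_exp x y h := by
    have h1 : x - y ∈ compactSubmodule H := (Submodule.Quotient.eq _).1 h
    have h2 : (x : BddOp H) - y ∈ compactIdeal H := h1
    have h3 := (I_smul_mem_compactIdeal H _).2 h2
    have h4 := compactIdeal_estimate H x y (le_max_left ‖x‖ ‖y‖) (le_max_right ‖x‖ ‖y‖)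
    rw [(norm_compactIdeal_eq_zero H _).2 h3, mul_zero] at h4
    have h5 := (norm_compactIdeal_eq_zero H _).1 (le_antisymm h4 (norm_nonneg _))
    have h6 := add_mem h5 h3
    rw [sub_add_cancel] at h6
    exact QuotientGroup.eq.2 ((inv_mul_mem_compactSubgroup H _ _).2 h6)
  lin_eq x y hx hy h := by
    have h1 := (inv_mul_mem_compactSubgroup H _ _).1 (QuotientGroup.eq.1 h)
    have h3 := compactIdeal_estimate H x y hx.le hy.le
    have h2 : (compactIdeal H).mkQ ((expUnitary x : BddOp H) - (expUnitary y : BddOp H)) = 0 :=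
      (Submodule.Quotient.mk_eq_zero _).2 h1
    rw [map_sub, h2, zero_sub, norm_neg] at h3
    have h4 := exp_half_lt_two
    have h5 : ‖(compactIdeal H).mkQ (Complex.I • ((x : BddOp H) - y))‖ = 0 := by
      nlinarith [norm_nonneg ((compactIdeal H).mkQ (Complex.I • ((x : BddOp H) - y)))]
    have h6 := (I_smul_mem_compactIdeal H _).1 ((norm_compactIdeal_eq_zero H _).1 h5)
    exact (Submodule.Quotient.eq _).2 h6

/-- The unitary group `U(H)`, with the norm topology. -/
abbrev UGroup : Type u := unitary (BddOp H)

/-- The projective unitary group `PU(H) = U(H) / U(1)`, with the quotient topology. -/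
abbrev PUGroup : Type u := UGroup H ⧸ scalarSubgroup (BddOp H)

/-- The quotient group `U(H) / U_K`, with the quotient topology. -/
abbrev UModUK : Type u := UGroup H ⧸ compactSubgroup H

/-- The Lie algebra of `U(H)`, the skew-adjoint operators `i x`, with `i x` written as `x`. -/
abbrev LieU : Type u := selfAdjoint (BddOp H)

/-- The Lie algebra of `PU(H)`. -/
abbrev LiePU : Type u := LieU H ⧸ scalarSubmodule (BddOp H)

/-- The Lie algebra of `U(H) / U_K`. -/
abbrev LieUModUK : Type u := LieU H ⧸ compactSubmodule H

noncomputable instance : ChartedSpace (LieU H) (UGroup H) := (unitaryExp (BddOp H)).chartedSpace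
noncomputable instance : ChartedSpace (LiePU H) (PUGroup H) := (projectiveExp (BddOp H)).chartedSpace
noncomputable instance : ChartedSpace (LieUModUK H) (UModUK H) := (calkinExp H).chartedSpace

instance : LieGroup 𝓘(ℝ, LieU H) ∞ (UGroup H) := (unitaryExp (BddOp H)).lieGroup
instance : LieGroup 𝓘(ℝ, LiePU H) ∞ (PUGroup H) := (projectiveExp (BddOp H)).lieGroup
instance : LieGroup 𝓘(ℝ, LieUModUK H) ∞ (UModUK H) := (calkinExp H).lieGroup

end Hilbert

section Projection

open selfAdjoint

variable {A : Type u} [CStarAlgebra A] {G : Type u} [Group G] [TopologicalSpace G]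
  [IsTopologicalGroup G] {E : Type u} [NormedAddCommGroup E] [NormedSpace ℝ E] [CompleteSpace E]

/-- The quotient map from the unitary group is smooth. -/
theorem ExpQuotient.contMDiff_proj (Q : ExpQuotient A G E) :
    letI := (unitaryExp A).chartedSpace
    letI := Q.chartedSpace
    ContMDiff 𝓘(ℝ, selfAdjoint A) 𝓘(ℝ, E) ∞ Q.proj := by
  let _ := (unitaryExp A).chartedSpace
  let _ := Q.chartedSpace
  intro a
  rw [contMDiffAt_iff]
  refine ⟨Q.proj_quot.continuous.continuousAt, ContDiffAt.contDiffWithinAt ?_⟩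
  have e0 : (extChartAt 𝓘(ℝ, selfAdjoint A) a) a = (0 : selfAdjoint A) := by
    show (unitaryExp A).expHomeo.symm (a⁻¹ * a) = 0
    rw [inv_mul_cancel, ← (unitaryExp A).expMap_zero, ← ExpQuotient.expHomeo_apply,
      (unitaryExp A).expHomeo.left_inv (unitaryExp A).zero_mem]
  rw [e0]
  refine (Q.contDiffAt_log (fun x => expUnitary x) 0
    ExpQuotient.contDiff_coe_expUnitary.contDiffAt ?_).congr_of_eventuallyEq
    (Filter.Eventually.of_forall fun x => ?_)
  · rw [expUnitary_zero, map_one]; exact Q.one_mem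
  · show Q.expHomeo.symm ((Q.proj a)⁻¹ * Q.proj (((unitaryExp A).chart a).symm x)) = _
    rw [ExpQuotient.chart_symm_apply]
    have := (unitaryExp A).expMap_lin x
    rw [show (unitaryExp A).expMap x = expUnitary x from this, map_mul, inv_mul_cancel_left]

variable (H : Type u) [NormedAddCommGroup H] [InnerProductSpace ℂ H] [CompleteSpace H]

/-- The projection `U(H) → PU(H)` is smooth. -/
theorem contMDiff_mk_PUGroup :
    ContMDiff 𝓘(ℝ, LieU H) 𝓘(ℝ, LiePU H) ∞ (fun v : UGroup H => (v : PUGroup H)) :=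
  (projectiveExp (BddOp H)).contMDiff_proj

/-- The projection `U(H) → U(H) / U_K` is smooth. -/
theorem contMDiff_mk_UModUK :
    ContMDiff 𝓘(ℝ, LieU H) 𝓘(ℝ, LieUModUK H) ∞ (fun v : UGroup H => (v : UModUK H)) :=
  (calkinExp H).contMDiff_proj

end Projection

section Forms

variable {k : ℕ}

/-- The representative of a field of alternating `k`-linear forms on the tangent spaces of `M`
in the chart around `x`. -/
noncomputable def localForm {E M : Type*} [NormedAddCommGroup E] [NormedSpace ℝ E]
    [TopologicalSpace M] [ChartedSpace E M]
    (η : ∀ x : M, TangentSpace 𝓘(ℝ, E) x [⋀^Fin k]→L[ℝ] ℝ) (x : M) (y : E) :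
    E [⋀^Fin k]→L[ℝ] ℝ :=
  (η ((chartAt E x).symm y)).compContinuousLinearMap
    (mfderiv 𝓘(ℝ, E) 𝓘(ℝ, E) (chartAt E x).symm y)

/-- Smooth real differential `k`-forms on a manifold `M` modelled on the Banach space `E`. -/
structure DiffForm (k : ℕ) (E M : Type*) [NormedAddCommGroup E] [NormedSpace ℝ E]
    [TopologicalSpace M] [ChartedSpace E M] where
  /-- The value of the form at a point. -/
  val : ∀ x : M, TangentSpace 𝓘(ℝ, E) x [⋀^Fin k]→L[ℝ] ℝ
  /-- The form is smooth in every chart. -/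
  smooth : ∀ x : M, ContDiffOn ℝ ∞ (localForm val x) (chartAt E x).target

namespace DiffForm

variable {E M : Type*} [NormedAddCommGroup E] [NormedSpace ℝ E]
  [TopologicalSpace M] [ChartedSpace E M]

/-- The value at `x` of the pullback `f^* η` of a form `η` along a map `f`. -/
noncomputable def pullback {E' H' N : Type*} [NormedAddCommGroup E'] [NormedSpace ℝ E']
    [TopologicalSpace H'] (I : ModelWithCorners ℝ E' H') [TopologicalSpace N] [ChartedSpace H' N]
    (f : N → M) (η : DiffForm k E M) (x : N) : TangentSpace I x [⋀^Fin k]→L[ℝ] ℝ :=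
  (η.val (f x)).compContinuousLinearMap (mfderiv I 𝓘(ℝ, E) f x)

/-- The value at `x` of the exterior derivative `dη`, computed in the chart around `x`. -/
noncomputable def extDer (η : DiffForm k E M) (x : M) :
    TangentSpace 𝓘(ℝ, E) x [⋀^Fin (k + 1)]→L[ℝ] ℝ :=
  (extDeriv (localForm η.val x) (chartAt E x x)).compContinuousLinearMap
    (mfderiv 𝓘(ℝ, E) 𝓘(ℝ, E) (chartAt E x) x)

/-- A form on a Lie group is bi-invariant if `L_g^* η = η = R_g^* η` for all `g`. -/
def IsBiInvariant [Group M] (η : DiffForm k E M) : Prop :=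
  ∀ g x : M, η.pullback 𝓘(ℝ, E) (fun h => g * h) x = η.val x ∧
    η.pullback 𝓘(ℝ, E) (fun h => h * g) x = η.val x

/-- A form on a Lie group `G` is primitive if `m^* η = pr₁^* η + pr₂^* η` on `G × G`, where `m` is
the multiplication. -/
def IsPrimitive [Group M] (η : DiffForm k E M) : Prop :=
  ∀ p : M × M, η.pullback (𝓘(ℝ, E).prod 𝓘(ℝ, E)) (fun q : M × M => q.1 * q.2) p =
    η.pullback (𝓘(ℝ, E).prod 𝓘(ℝ, E)) Prod.fst p +
      η.pullback (𝓘(ℝ, E).prod 𝓘(ℝ, E)) Prod.snd p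

end DiffForm

variable {H : Type u} [NormedAddCommGroup H] [InnerProductSpace ℂ H] [CompleteSpace H]

/-- `A` is (the real form of) a connection on the principal `U(1)`-bundle `U(H) → PU(H)`: the
connection form is `i A`, where the real 1-form `A` is invariant under the action of `U(1)` on
`U(H)` and takes the value `1` on the velocity of `t ↦ u e^{it}` at `t = 0`. -/
structure IsConnection (A : DiffForm 1 (LieU H) (UGroup H)) : Prop where
  invariant : ∀ (z : Circle) (u : UGroup H),
    A.pullback 𝓘(ℝ, LieU H) (fun v => v * scalarUnitary (BddOp H) z) u = A.val u
  vertical : ∀ u : UGroup H,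
    A.pullback 𝓘(ℝ, ℝ) (fun t : ℝ => u * scalarUnitary (BddOp H) (Circle.exp t)) 0
      (fun _ => (1 : ℝ)) = 1

/-- `F` is (the real form of) the curvature of the connection `A` on `π : U(H) → PU(H)`: it is the
2-form on `PU(H)` with `π^* F = dA`. -/
def IsCurvature (A : DiffForm 1 (LieU H) (UGroup H)) (F : DiffForm 2 (LiePU H) (PUGroup H)) : Prop :=
  ∀ u : UGroup H, F.pullback 𝓘(ℝ, LieU H) (fun v : UGroup H => (v : PUGroup H)) u = A.extDer u

end Forms

/-!
Let `θ` be the value at the identity of a bi-invariant 2-form, lifted to an alternating form on the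
self-adjoint operators. It is invariant under the adjoint action of the unitary group, hence under
the Lie bracket (`bracket_invariant`). So `(x, y, z) ↦ θ ([x, y], z)` is antisymmetric in `x, y` and
symmetric in `y, z`, and therefore zero (`bracket_eq_zero`). On an infinite-dimensional Hilbert
space every bounded operator is a sum of commutators (`exists_eq_commutator_add_commutator`), so
every self-adjoint operator is a sum of brackets and `θ = 0`. The argument applies to all quotients
of the unitary group with the exponential charts
(`ExpQuotient.biInvariant_two_form_eq_zero`).

A primitive form is bi-invariant (`DiffForm.IsPrimitive.isBiInvariant`), so a primitive curvature
vanishes and the connection form `A` is closed. The integral of a closed 1-form over a smooth loop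
of unitaries is invariant under homotopy (`loopIntegral_homotopy`). For the loop
`t ↦ e^{it} p + (1 - p)` of a projection `p`, rotations between the ranges of orthogonal equivalent
projections `p, q` show that the integrals for `p` and `q` agree, and that the integral for `p + q`
is twice the one for `q` (`phaseIntegral_eq`, `phaseIntegral_add`). As `1` is a sum of two
projections that are equivalent to their own halves, the integral over the loop of scalars is zero,
whereas for a connection form it is `2π` (`IsConnection.not_closed`).
-/

/-! ### Isometries with complementary ranges, and commutators -/

section CuntzPair

open scoped InnerProductSpace

variable {H : Type u} [NormedAddCommGroup H] [InnerProductSpace ℂ H] [CompleteSpace H]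

/-- An injective self-map of a Hilbert basis extends to an isometry. -/
theorem exists_clm_map_hilbertBasis {ι : Type*} (b : HilbertBasis ι ℂ H) (j : ι → ι)
    (hj : Function.Injective j) :
    ∃ v : H →L[ℂ] H, star v * v = 1 ∧ ∀ i, v (b i) = b (j i) := by
  classical
  have ho : Orthonormal ℂ (fun i => b (j i)) := b.orthonormal.comp j hj
  let T : H →ₗᵢ[ℂ] H := ho.orthogonalFamily.linearIsometry.comp b.repr.toLinearIsometry
  refine ⟨T.toContinuousLinearMap, ?_, fun i => ?_⟩
  · ext x
    refine ext_inner_left ℂ fun y => ?_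
    rw [mul_apply_eq_comp, ContinuousLinearMap.star_eq_adjoint,
      ContinuousLinearMap.adjoint_inner_right]
    exact T.inner_map_map y x
  · show ho.orthogonalFamily.linearIsometry (b.repr (b i)) = _
    rw [b.repr_self, OrthogonalFamily.linearIsometry_apply_single]
    simp

theorem clm_ext_hilbertBasis {H : Type*} [NormedAddCommGroup H] [InnerProductSpace ℂ H]
    {ι : Type*} (b : HilbertBasis ι ℂ H) {S T : H →L[ℂ] H}
    (h : ∀ i, S (b i) = T (b i)) : S = T := by
  refine ContinuousLinearMap.ext_on (s := Set.range b)
    (Submodule.dense_iff_topologicalClosure_eq_top.2 b.dense_span) ?_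
  rintro _ ⟨i, rfl⟩
  exact h i

/-- The index set `ι` of a Hilbert basis is infinite, so `ι ⊕ ι ≃ ι`; the two halves of the basis
give isometries whose ranges are orthogonal complements of each other. -/
theorem exists_cuntz_pair_clm (hH : ¬ FiniteDimensional ℂ H) :
    ∃ v w : H →L[ℂ] H, star v * v = 1 ∧ star w * w = 1 ∧ star v * w = 0 ∧
      v * star v + w * star w = 1 := by
  classical
  obtain ⟨ι, b, -⟩ := exists_hilbertBasis ℂ H
  have hι : Infinite ι := by
    by_contra hfin
    have : Finite ι := not_infinite_iff_finite.1 hfin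
    have : Fintype ι := Fintype.ofFinite ι
    exact hH b.toOrthonormalBasis.toBasis.finiteDimensional_of_finite
  obtain ⟨e⟩ : Nonempty ((ι ⊕ ι) ≃ ι) := by
    rw [← Cardinal.eq, Cardinal.mk_sum, Cardinal.lift_id]
    exact Cardinal.add_eq_self (Cardinal.aleph0_le_mk ι)
  obtain ⟨v, hv, hvb⟩ := exists_clm_map_hilbertBasis b _ (e.injective.comp Sum.inl_injective)
  obtain ⟨w, hw, hwb⟩ := exists_clm_map_hilbertBasis b _ (e.injective.comp Sum.inr_injective)
  have hvw : star v * w = 0 := by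
    refine clm_ext_hilbertBasis b fun i => ?_
    refine b.repr.injective (lp.ext (funext fun k => ?_))
    rw [b.repr_apply_apply, mul_apply_eq_comp, ContinuousLinearMap.star_eq_adjoint,
      ContinuousLinearMap.adjoint_inner_right, hvb, hwb, b.orthonormal.inner_eq_zero]
    · simp
    · simp
  have hwv : star w * v = 0 := by simpa using congrArg star hvw
  refine ⟨v, w, hv, hw, hvw, clm_ext_hilbertBasis b fun i => ?_⟩
  obtain ⟨k, rfl⟩ := e.surjective i
  rcases k with k | k
  · have h : (v * star v + w * star w) * v = v := by
      rw [add_mul, mul_assoc, mul_assoc, hv, hwv, mul_one, mul_zero, add_zero]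
    have := congrArg (fun T : H →L[ℂ] H => T (b k)) h
    rwa [mul_apply_eq_comp, hvb] at this
  · have h : (v * star v + w * star w) * w = w := by
      rw [add_mul, mul_assoc, mul_assoc, hw, hvw, mul_one, mul_zero, zero_add]
    have := congrArg (fun T : H →L[ℂ] H => T (b k)) h
    rwa [mul_apply_eq_comp, hwb] at this

/-- The infinite ampliation of `a` along the orthogonal isometries `vⁿ w`, that is
`∑ vⁿ w a w* v*ⁿ` (a strongly convergent sum), differs from its own shift by `w a w*`. -/
theorem exists_ampliation_clm {v w : H →L[ℂ] H} (hv : star v * v = 1) (hw : star w * w = 1)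
    (hvw : star v * w = 0) (a : H →L[ℂ] H) :
    ∃ P : H →L[ℂ] H, P = w * a * star w + v * P * star v := by
  classical
  let V : ℕ → H →L[ℂ] H := fun n => v ^ n * w
  have hVs : ∀ n, V (n + 1) = v * V n := fun n => by simp only [V, pow_succ', mul_assoc]
  have hVV : ∀ n, star (V n) * V n = 1 := fun n => by
    induction n with
    | zero => simpa [V] using hw
    | succ n ih => rw [hVs, star_mul, mul_assoc, ← mul_assoc _ v, hv, one_mul, ih]
  have hV0 : ∀ m n, m < n → star (V n) * V m = 0 := by
    intro m
    induction m with
    | zero =>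
      intro n hn
      obtain ⟨k, rfl⟩ := Nat.exists_eq_succ_of_ne_zero hn.ne'
      rw [Nat.succ_eq_add_one, hVs, star_mul, mul_assoc]
      simp [V, hvw]
    | succ m ih =>
      intro n hn
      obtain ⟨k, rfl⟩ := Nat.exists_eq_succ_of_ne_zero (Nat.ne_zero_of_lt hn)
      rw [Nat.succ_eq_add_one, hVs, hVs, star_mul, mul_assoc, ← mul_assoc _ v, hv, one_mul]
      exact ih k (by omega)
  have hadj : ∀ m n x y, ⟪V n x, V m y⟫_ℂ = ⟪x, (star (V n) * V m) y⟫_ℂ := fun m n x y => by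
    rw [mul_apply_eq_comp, ContinuousLinearMap.star_eq_adjoint]
    exact (ContinuousLinearMap.adjoint_inner_right (V n) x (V m y)).symm
  let T : ℕ → H →ₗᵢ[ℂ] H := fun n => (V n).toLinearMap.isometryOfInner fun x y => by
    have := hadj n n x y
    rw [hVV] at this
    exact this
  have hT : OrthogonalFamily ℂ (fun _ : ℕ => H) T := by
    intro m n hmn x y
    show ⟪V m x, V n y⟫_ℂ = 0
    rcases lt_or_gt_of_ne hmn with h | h
    · rw [← inner_conj_symm, hadj, hV0 m n h]; simp
    · rw [hadj, hV0 n m h]; simp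
  -- `W` assembles the isometries `V n` into one isometry from the Hilbert sum of copies of `H`, and
  -- `M` applies `a` in each summand.
  let W : lp (fun _ : ℕ => H) 2 →L[ℂ] H := hT.linearIsometry.toContinuousLinearMap
  let M : lp (fun _ : ℕ => H) 2 →L[ℂ] lp (fun _ : ℕ => H) 2 :=
    lp.mapCLM 2 (fun _ => a) (norm_nonneg a) fun _ => le_rfl
  let P : H →L[ℂ] H := W ∘L M ∘L ContinuousLinearMap.adjoint W
  have hW : ∀ h n, ContinuousLinearMap.adjoint W h n = star (V n) h := fun h n => by
    refine ext_inner_left ℂ fun y => ?_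
    have h1 := lp.inner_single_left (𝕜 := ℂ) (G := fun _ : ℕ => H) n y
      (ContinuousLinearMap.adjoint W h)
    rw [ContinuousLinearMap.adjoint_inner_right] at h1
    refine h1.symm.trans ?_
    rw [ContinuousLinearMap.star_eq_adjoint, ContinuousLinearMap.adjoint_inner_right]
    exact congrArg (⟪·, h⟫_ℂ) (hT.linearIsometry_apply_single (i := n) y)
  have hP : ∀ h, HasSum (fun n => V n (a (star (V n) h))) (P h) := fun h => by
    have := hT.hasSum_linearIsometry (M (ContinuousLinearMap.adjoint W h))
    refine this.congr_fun fun n => ?_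
    show V n (a (star (V n) h)) = V n (a (ContinuousLinearMap.adjoint W h n))
    rw [hW]
  refine ⟨P, ContinuousLinearMap.ext fun h => ?_⟩
  have h1 := (hasSum_nat_add_iff' 1).2 (hP h)
  have h2 := (hP (star v h)).mapL v
  have h3 : ∀ n, V (n + 1) (a (star (V (n + 1)) h)) = v (V n (a (star (V n) (star v h)))) :=
    fun n => by rw [hVs, star_mul]; rfl
  have h4 := h1.unique (h2.congr_fun h3)
  rw [Finset.sum_range_one, sub_eq_iff_eq_add'] at h4
  simpa [V] using h4

end CuntzPair

section Commutators

variable {H : Type u} [NormedAddCommGroup H] [InnerProductSpace ℂ H] [CompleteSpace H]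

/-- Two isometries with orthogonal ranges that together span `H`. -/
theorem exists_cuntz_pair (hH : ¬ FiniteDimensional ℂ H) :
    ∃ v w : BddOp H, star v * v = 1 ∧ star w * w = 1 ∧ star v * w = 0 ∧
      v * star v + w * star w = 1 :=
  exists_cuntz_pair_clm hH

/-- Every bounded operator on an infinite-dimensional Hilbert space is a sum of two commutators:
with `v, w` a pair of isometries as above and `P` the ampliation of `a`, the operator `a` is
`[w*, w a] + [v*, v P]`. -/
theorem exists_eq_commutator_add_commutator (hH : ¬ FiniteDimensional ℂ H) (a : BddOp H) :
    ∃ b c b' c' : BddOp H, a = (b * c - c * b) + (b' * c' - c' * b') := by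
  obtain ⟨v, w, hv, hw, hvw, -⟩ := exists_cuntz_pair hH
  obtain ⟨P, hP⟩ : ∃ P : BddOp H, P = w * a * star w + v * P * star v :=
    exists_ampliation_clm hv hw hvw a
  refine ⟨star w, w * a, star v, v * P, ?_⟩
  rw [← mul_assoc, ← mul_assoc, hw, hv, one_mul, one_mul, eq_sub_of_add_eq' hP.symm]
  abel

end Commutators

/-! ### Invariant alternating forms on the Lie algebra -/

section Adjoint

open selfAdjoint

variable {A : Type u} [CStarAlgebra A]

/-- The adjoint action `x ↦ u x u*` of a unitary on the self-adjoint elements. -/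
def unitaryConj (u : unitary A) (x : selfAdjoint A) : selfAdjoint A :=
  ⟨(u : A) * x * star (u : A), x.2.conjugate (u : A)⟩

/-- The Lie bracket of `selfAdjoint A`, regarded as the Lie algebra of the unitary group through
`x ↦ i x`, up to sign: `(z, x) ↦ i (z x - x z)`. -/
noncomputable def selfAdjointBracket (z x : selfAdjoint A) : selfAdjoint A :=
  ⟨Complex.I • ((z : A) * x - x * z), by
    rw [selfAdjoint.mem_iff, star_smul, star_sub, star_mul, star_mul, x.2.star_eq, z.2.star_eq,
      Complex.star_def, Complex.conj_I, neg_smul, ← smul_neg, neg_sub]⟩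

theorem selfAdjointBracket_comm (z x : selfAdjoint A) :
    selfAdjointBracket z x = -selfAdjointBracket x z :=
  Subtype.ext (by
    show Complex.I • ((z : A) * x - x * z) = -(Complex.I • ((x : A) * z - z * x))
    rw [← smul_neg, neg_sub])

theorem expUnitary_unitaryConj (u : unitary A) (x : selfAdjoint A) :
    expUnitary (unitaryConj u x) = u * expUnitary x * u⁻¹ := by
  let _ : NormedAlgebra ℚ A := NormedAlgebra.restrictScalars ℚ ℂ A
  ext1
  have h := NormedSpace.exp_units_conj (Unitary.toUnits u) (Complex.I • (x : A))
  have e : Complex.I • ((unitaryConj u x : selfAdjoint A) : A) =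
      (u : A) * (Complex.I • (x : A)) * star (u : A) := by
    simp [unitaryConj]
  rw [expUnitary_coe, e]
  exact h

theorem coe_selfAdjointPartL (x : selfAdjoint A) : selfAdjointPartL ℝ A (x : A) = x :=
  Subtype.ext (IsSelfAdjoint.coe_selfAdjointPart_apply ℝ x.2)

/-- The self-adjoint part of a commutator is a sum of two Lie brackets. -/
theorem selfAdjointPartL_commutator (b c : A) : ∃ b₁ b₂ c₁ c₂ : selfAdjoint A,
    selfAdjointPartL ℝ A (b * c - c * b) =
      selfAdjointBracket b₁ c₂ + selfAdjointBracket b₂ c₁ := by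
  refine ⟨realPart b, imaginaryPart b, realPart c, imaginaryPart c, Subtype.ext ?_⟩
  have e : selfAdjointBracket (realPart b) (imaginaryPart c) +
      selfAdjointBracket (imaginaryPart b) (realPart c) =
      (selfAdjointPartL ℝ A (b * c - c * b)) := by
    rw [← coe_selfAdjointPartL (_ + _)]
    have hb := realPart_add_I_smul_imaginaryPart b
    have hc := realPart_add_I_smul_imaginaryPart c
    set b₁ := realPart b
    set b₂ := imaginaryPart b
    set c₁ := realPart c
    set c₂ := imaginaryPart c
    rw [← sub_eq_zero, ← map_sub]
    -- The difference of the two sides is skew-adjoint.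
    have hz : ∀ y : A, star y = -y → selfAdjointPartL ℝ A y = 0 := fun y hy =>
      Subtype.ext (by simp [selfAdjointPartL, selfAdjointPart_apply_coe, hy])
    refine hz _ ?_
    have key : ((selfAdjointBracket b₁ c₂ + selfAdjointBracket b₂ c₁ : selfAdjoint A) : A) -
        (b * c - c * b) = (c₁ * b₁ - b₁ * c₁ : A) + (b₂ * c₂ - c₂ * b₂ : A) := by
      rw [← hb, ← hc]
      simp only [selfAdjointBracket, AddSubgroup.coe_add, mul_add, add_mul, smul_mul_assoc,
        mul_smul_comm, smul_smul, Complex.I_mul_I, neg_smul, one_smul, smul_sub,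
        smul_add]
      abel
    rw [key]
    simp only [star_add, star_sub, star_mul, b₁.2.star_eq, b₂.2.star_eq, c₁.2.star_eq,
      c₂.2.star_eq]
    abel
  rw [e]

/-- The adjoint action of `exp (i t z)` has derivative the Lie bracket with `z`. -/
theorem hasDerivAt_unitaryConj_expUnitary (z x : selfAdjoint A) :
    HasDerivAt (fun t : ℝ => unitaryConj (expUnitary (t • z)) x) (selfAdjointBracket z x) 0 := by
  have h1 : HasDerivAt (fun t : ℝ => NormedSpace.exp (t • (Complex.I • (z : A))))
      (Complex.I • (z : A)) 0 := by
    simpa using hasDerivAt_exp_smul_const (𝕂 := ℝ) (Complex.I • (z : A)) (0 : ℝ)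
  have h2 : HasDerivAt (fun t : ℝ => NormedSpace.exp (t • (-(Complex.I • (z : A)))))
      (-(Complex.I • (z : A))) 0 := by
    simpa using hasDerivAt_exp_smul_const (𝕂 := ℝ) (-(Complex.I • (z : A))) (0 : ℝ)
  have h3 := (selfAdjointPartL ℝ A).hasFDerivAt.comp_hasDerivAt (0 : ℝ)
    ((h1.mul_const (x : A)).mul h2)
  have e1 : ∀ t : ℝ, Complex.I • ((t • z : selfAdjoint A) : A) = t • (Complex.I • (z : A)) :=
    fun t => (smul_comm Complex.I t (z : A))
  have e2 : (fun t : ℝ => unitaryConj (expUnitary (t • z)) x) = (selfAdjointPartL ℝ A) ∘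
      ((fun t : ℝ => NormedSpace.exp (t • (Complex.I • (z : A))) * (x : A)) *
        fun t : ℝ => NormedSpace.exp (t • (-(Complex.I • (z : A))))) := by
    funext t
    rw [← coe_selfAdjointPartL (unitaryConj _ x)]
    show _ = selfAdjointPartL ℝ A (NormedSpace.exp (t • (Complex.I • (z : A))) * (x : A) *
      NormedSpace.exp (t • (-(Complex.I • (z : A)))))
    congr 1
    show ((expUnitary (t • z) : unitary A) : A) * x * star ((expUnitary (t • z) : unitary A) : A) = _
    rw [expUnitary_coe, NormedSpace.star_exp, e1, smul_neg]
    simp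
  have e3 : selfAdjointBracket z x = selfAdjointPartL ℝ A
      (Complex.I • (z : A) * x * NormedSpace.exp ((0 : ℝ) • (-(Complex.I • (z : A)))) +
        NormedSpace.exp ((0 : ℝ) • (Complex.I • (z : A))) * x * -(Complex.I • (z : A))) := by
    rw [← coe_selfAdjointPartL (selfAdjointBracket z x)]
    congr 1
    simp [selfAdjointBracket, sub_eq_add_neg]
  rw [e2, e3]
  exact h3

theorem update_vec_two_zero {α : Type*} (a b c : α) : Function.update ![a, b] 0 c = ![c, b] := by
  funext i; fin_cases i <;> rfl

theorem update_vec_two_one {α : Type*} (a b c : α) : Function.update ![a, b] 1 c = ![a, c] := by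
  funext i; fin_cases i <;> rfl

/-- An alternating form that is invariant under the adjoint action is invariant under the Lie
bracket: differentiate along `exp (i t z)` at `t = 0`. The map `l` stands for the projection to the
Lie algebra of a quotient group. -/
theorem bracket_invariant {E : Type u} [NormedAddCommGroup E] [NormedSpace ℝ E]
    (l : selfAdjoint A →L[ℝ] E) (θ : E [⋀^Fin 2]→L[ℝ] ℝ)
    (hθ : ∀ u x y, θ ![l (unitaryConj u x), l (unitaryConj u y)] = θ ![l x, l y])
    (z x y : selfAdjoint A) :
    θ ![l (selfAdjointBracket z x), l y] + θ ![l x, l (selfAdjointBracket z y)] = 0 := by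
  have hx := l.hasFDerivAt.comp_hasDerivAt (0 : ℝ) (hasDerivAt_unitaryConj_expUnitary z x)
  have hy := l.hasFDerivAt.comp_hasDerivAt (0 : ℝ) (hasDerivAt_unitaryConj_expUnitary z y)
  have hxy : HasDerivAt (fun t : ℝ => ![l (unitaryConj (expUnitary (t • z)) x),
      l (unitaryConj (expUnitary (t • z)) y)])
      ![l (selfAdjointBracket z x), l (selfAdjointBracket z y)] 0 := by
    rw [hasDerivAt_pi]
    intro i
    fin_cases i
    · exact hx
    · exact hy
  have h0 : ∀ x, unitaryConj (expUnitary ((0 : ℝ) • z)) x = x := fun x =>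
    Subtype.ext (by simp [unitaryConj])
  have h := (θ.toContinuousMultilinearMap.hasFDerivAt _).comp_hasDerivAt (0 : ℝ) hxy
  have hc : (fun t : ℝ => θ.toContinuousMultilinearMap ![l (unitaryConj (expUnitary (t • z)) x),
      l (unitaryConj (expUnitary (t • z)) y)]) = fun _ => θ ![l x, l y] :=
    funext fun t => hθ _ x y
  have h2 := (show HasDerivAt (fun t : ℝ => θ.toContinuousMultilinearMap
      ![l (unitaryConj (expUnitary (t • z)) x),
      l (unitaryConj (expUnitary (t • z)) y)]) _ 0 from h).unique
        (by rw [hc]; exact hasDerivAt_const _ _)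
  rw [ContinuousMultilinearMap.linearDeriv_apply, Fin.sum_univ_two] at h2
  simp only [h0, Matrix.cons_val_zero, Matrix.cons_val_one, update_vec_two_zero,
    update_vec_two_one] at h2
  exact h2

/-- A bracket-invariant alternating 2-form vanishes on brackets: `(z, x, y) ↦ θ ([z, x], y)` is
antisymmetric in `z, x` and symmetric in `x, y`. -/
theorem bracket_eq_zero {E : Type u} [NormedAddCommGroup E] [NormedSpace ℝ E]
    (l : selfAdjoint A →L[ℝ] E) (θ : E [⋀^Fin 2]→L[ℝ] ℝ)
    (hθ : ∀ u x y, θ ![l (unitaryConj u x), l (unitaryConj u y)] = θ ![l x, l y])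
    (z x y : selfAdjoint A) : θ ![l (selfAdjointBracket z x), l y] = 0 := by
  have hswap : ∀ a b : E, θ ![a, b] = -θ ![b, a] := fun a b => by
    have := θ.map_swap ![b, a] (show (0 : Fin 2) ≠ 1 by decide)
    rw [show ![b, a] ∘ Equiv.swap (0 : Fin 2) 1 = ![a, b] by
      funext i; fin_cases i <;> rfl] at this
    exact this
  have hneg : ∀ a b : E, θ ![-a, b] = -θ ![a, b] := fun a b => by
    simpa only [update_vec_two_zero, neg_smul, one_smul] using θ.map_update_smul ![a, b] 0 (-1 : ℝ) a
  have hsymm : ∀ z x y, θ ![l (selfAdjointBracket z x), l y] =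
      θ ![l (selfAdjointBracket z y), l x] := fun z x y => by
    have := bracket_invariant l θ hθ z x y
    rw [hswap (l x)] at this
    linarith
  have hanti : ∀ z x y, θ ![l (selfAdjointBracket z x), l y] =
      -θ ![l (selfAdjointBracket x z), l y] := fun z x y => by
    rw [selfAdjointBracket_comm, map_neg, hneg]
  have h1 := hsymm z x y
  have h2 := hanti z y x
  have h3 := hsymm y z x
  have h4 := hanti y x z
  have h5 := hsymm x y z
  have h6 := hanti x z y
  linarith

end Adjoint

/-! ### Bi-invariant forms on quotients of the unitary group -/

section BiInvariant

open selfAdjoint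

namespace ExpQuotient

variable {A : Type u} [CStarAlgebra A] {G : Type u} [Group G] [TopologicalSpace G]
  [IsTopologicalGroup G] {E : Type u} [NormedAddCommGroup E] [NormedSpace ℝ E] [CompleteSpace E]
  (Q : ExpQuotient A G E)

theorem expHomeo_symm_one : Q.expHomeo.symm 1 = 0 := by
  rw [← Q.expMap_zero, ← expHomeo_apply, Q.expHomeo.left_inv Q.zero_mem]

theorem eventually_expHomeo_symm_expMap : ∀ᶠ y in 𝓝 (0 : E), Q.expHomeo.symm (Q.expMap y) = y := by
  filter_upwards [Q.expHomeo.open_source.mem_nhds Q.zero_mem] with y hy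
  exact Q.expHomeo.left_inv hy

/-- In the charts by left translates of the exponential map, left translations have derivative the
identity. -/
theorem hasMFDerivAt_mul_left (g h : G) :
    letI := Q.chartedSpace
    HasMFDerivAt 𝓘(ℝ, E) 𝓘(ℝ, E) (fun k : G => g * k) h (ContinuousLinearMap.id ℝ E) := by
  let _ := Q.chartedSpace
  refine ⟨(continuous_const_mul g).continuousAt, HasFDerivAt.hasFDerivWithinAt ?_⟩
  have e0 : extChartAt 𝓘(ℝ, E) h h = (0 : E) := by
    show Q.expHomeo.symm (h⁻¹ * h) = 0
    rw [inv_mul_cancel, expHomeo_symm_one]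
  rw [e0]
  refine (hasFDerivAt_id (0 : E)).congr_of_eventuallyEq ?_
  filter_upwards [Q.eventually_expHomeo_symm_expMap] with y hy
  show Q.expHomeo.symm ((g * h)⁻¹ * (g * (Q.chart h).symm y)) = y
  rw [chart_symm_apply, ← mul_assoc g, inv_mul_cancel_left, hy]

/-- The curve `t ↦ g exp (t y)` has velocity `y` at `t = 0`. -/
theorem hasMFDerivAt_mul_expMap (g : G) (y : E) :
    letI := Q.chartedSpace
    HasMFDerivAt 𝓘(ℝ, ℝ) 𝓘(ℝ, E) (fun t : ℝ => g * Q.expMap (t • y)) 0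
      (ContinuousLinearMap.toSpanSingleton ℝ y) := by
  let _ := Q.chartedSpace
  refine ⟨?_, HasFDerivAt.hasFDerivWithinAt ?_⟩
  · exact (continuous_const.mul (Q.continuous_expMap.comp
      (continuous_id.smul continuous_const))).continuousAt
  have h0 : Filter.Tendsto (fun t : ℝ => t • y) (𝓝 0) (𝓝 0) := by
    have : Continuous fun t : ℝ => t • y := by fun_prop
    simpa using this.tendsto 0
  have h1 : HasFDerivAt (fun t : ℝ => t • y) (ContinuousLinearMap.toSpanSingleton ℝ y) 0 :=
    (ContinuousLinearMap.toSpanSingleton ℝ y).hasFDerivAt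
  refine h1.congr_of_eventuallyEq ?_
  filter_upwards [h0.eventually Q.eventually_expHomeo_symm_expMap] with t ht
  show Q.expHomeo.symm ((g * Q.expMap ((0 : ℝ) • y))⁻¹ * (g * Q.expMap (t • y))) = t • y
  rw [zero_smul, Q.expMap_zero, mul_one, inv_mul_cancel_left, ht]

/-- In the charts by left translates of the exponential map, the right translation by `u⁻¹` has
derivative the adjoint action of `u`. -/
theorem mfderiv_mul_right (u : unitary A) (h : G) (x : selfAdjoint A) :
    letI := Q.chartedSpace
    (mfderiv 𝓘(ℝ, E) 𝓘(ℝ, E) (fun k : G => k * (Q.proj u)⁻¹) h : E →L[ℝ] E) (Q.lin x) =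
      Q.lin (unitaryConj u x) := by
  let _ := Q.chartedSpace
  have := Q.lieGroup
  -- Compare the velocities of `h exp (t x) u⁻¹ = h u⁻¹ exp (t u x u*)`, computed in two ways.
  let c : ℝ → G := fun t => h * Q.expMap (t • Q.lin x)
  have hc0 : c 0 = h := by simp [c, Q.expMap_zero]
  have hR : ∀ k, k = h → HasMFDerivAt 𝓘(ℝ, E) 𝓘(ℝ, E) (fun k : G => k * (Q.proj u)⁻¹) k
      (mfderiv 𝓘(ℝ, E) 𝓘(ℝ, E) (fun k : G => k * (Q.proj u)⁻¹) h : E →L[ℝ] E) := by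
    rintro _ rfl
    exact ((contMDiff_mul_right (I := 𝓘(ℝ, E)) (n := ∞)).mdifferentiable (by simp) _).hasMFDerivAt
  have h1 := HasMFDerivAt.comp (0 : ℝ) (hR (c 0) hc0) (Q.hasMFDerivAt_mul_expMap h (Q.lin x))
  have h2 := Q.hasMFDerivAt_mul_expMap (h * (Q.proj u)⁻¹) (Q.lin (unitaryConj u x))
  have e : (fun k : G => k * (Q.proj u)⁻¹) ∘ (fun t : ℝ => h * Q.expMap (t • Q.lin x)) =
      fun t : ℝ => h * (Q.proj u)⁻¹ * Q.expMap (t • Q.lin (unitaryConj u x)) := by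
    funext t
    have ht : unitaryConj u (t • x) = t • unitaryConj u x :=
      Subtype.ext (by simp [unitaryConj])
    rw [Function.comp_apply, ← map_smul, ← map_smul, ← ht, expMap_lin, expMap_lin,
      expUnitary_unitaryConj, map_mul, map_mul, map_inv]
    group
  rw [e] at h1
  have h3 := hasMFDerivAt_unique h1 h2
  have h4 : (mfderiv 𝓘(ℝ, E) 𝓘(ℝ, E) (fun k : G => k * (Q.proj u)⁻¹) h : E →L[ℝ] E)
      ((1 : ℝ) • Q.lin x) = (1 : ℝ) • Q.lin (unitaryConj u x) :=
    congrArg (fun D : ℝ →L[ℝ] E => D 1) h3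
  rwa [one_smul, one_smul] at h4

/-- The value at `1` of a bi-invariant form is invariant under the adjoint action, and determines
the form. -/
theorem biInvariant_eq {k : ℕ} :
    letI := Q.chartedSpace
    ∀ η : DiffForm k E G, η.IsBiInvariant →
      (∀ g, (η.val g : E [⋀^Fin k]→L[ℝ] ℝ) = η.val 1) ∧
      ∀ (u : unitary A) (x : Fin k → selfAdjoint A),
        (η.val 1 : E [⋀^Fin k]→L[ℝ] ℝ) (fun i => Q.lin (unitaryConj u (x i))) =
          (η.val 1 : E [⋀^Fin k]→L[ℝ] ℝ) (fun i => Q.lin (x i)) := by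
  let _ := Q.chartedSpace
  intro η hη
  -- All tangent spaces are definitionally `E`, so that the values of `η` at different points can be
  -- compared.
  let ev : G → E [⋀^Fin k]→L[ℝ] ℝ := η.val
  have h1 : ∀ g, ev g = ev 1 := fun g => by
    have := (hη g 1).1
    rw [DiffForm.pullback, (Q.hasMFDerivAt_mul_left g 1).mfderiv] at this
    have h2 : ev (g * 1) = ev 1 := by
      rw [← show _ = ev 1 from this]; rfl
    rwa [mul_one] at h2
  refine ⟨h1, fun u x => ?_⟩
  have h2 := (hη (Q.proj u)⁻¹ 1).2
  have h3 := congrArg (fun θ : E [⋀^Fin k]→L[ℝ] ℝ => θ fun i => Q.lin (x i)) h2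
  have h4 : ev (1 * (Q.proj u)⁻¹) (fun i => (mfderiv 𝓘(ℝ, E) 𝓘(ℝ, E)
      (fun k : G => k * (Q.proj u)⁻¹) 1 : E →L[ℝ] E) (Q.lin (x i))) =
      ev 1 fun i => Q.lin (x i) := h3
  simp only [Q.mfderiv_mul_right] at h4
  rw [h1] at h4
  exact h4

end ExpQuotient

variable {H : Type u} [NormedAddCommGroup H] [InnerProductSpace ℂ H] [CompleteSpace H]

/-- Bi-invariant 2-forms vanish on every quotient of the unitary group of an infinite-dimensional
Hilbert space: its Lie algebra is spanned by brackets. -/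
theorem ExpQuotient.biInvariant_two_form_eq_zero (hH : ¬ FiniteDimensional ℂ H)
    {G : Type u} [Group G] [TopologicalSpace G] [IsTopologicalGroup G] {E : Type u}
    [NormedAddCommGroup E] [NormedSpace ℝ E] [CompleteSpace E] (Q : ExpQuotient (BddOp H) G E) :
    letI := Q.chartedSpace
    ∀ η : DiffForm 2 E G, η.IsBiInvariant → ∀ g, η.val g = 0 := by
  let _ := Q.chartedSpace
  intro η hη g
  obtain ⟨h1, h2⟩ := Q.biInvariant_eq η hη
  refine (h1 g).trans ?_
  let θ : E [⋀^Fin 2]→L[ℝ] ℝ := η.val 1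
  have hpair : ∀ f : selfAdjoint (BddOp H) → E, ∀ x y,
      (fun i => f (![x, y] i)) = ![f x, f y] := fun f x y => by
    funext i; fin_cases i <;> rfl
  have hθ : ∀ u x y, θ ![Q.lin (unitaryConj u x), Q.lin (unitaryConj u y)] =
      θ ![Q.lin x, Q.lin y] := fun u x y => by
    have h3 := h2 u ![x, y]
    rw [hpair (fun x => Q.lin (unitaryConj u x)), hpair (fun x => Q.lin x)] at h3
    exact h3
  have h0 := bracket_eq_zero Q.lin θ hθ
  have hadd : ∀ a b c : E, θ ![a + b, c] = θ ![a, c] + θ ![b, c] := fun a b c => by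
    simpa only [update_vec_two_zero] using θ.map_update_add ![a, c] 0 a b
  have hcomm : ∀ (b c : BddOp H) y,
      θ ![Q.lin (selfAdjointPartL ℝ (BddOp H) (b * c - c * b)), y] = 0 := fun b c y => by
    obtain ⟨b₁, b₂, c₁, c₂, h⟩ := selfAdjointPartL_commutator b c
    obtain ⟨y, rfl⟩ := Q.lin_surj y
    rw [h, map_add, hadd, h0, h0, add_zero]
  show θ = 0
  ext v
  obtain ⟨x, hx⟩ := Q.lin_surj (v 0)
  obtain ⟨b, c, b', c', h⟩ := exists_eq_commutator_add_commutator hH (x : BddOp H)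
  have hv : v = ![v 0, v 1] := by funext i; fin_cases i <;> rfl
  rw [hv, ← hx, ← coe_selfAdjointPartL x, h, map_add, map_add, hadd, hcomm, hcomm, add_zero]
  rfl

end BiInvariant

/-! ### Primitive forms are bi-invariant -/

section Primitive

variable {E M : Type*} [NormedAddCommGroup E] [NormedSpace ℝ E] [TopologicalSpace M]
  [ChartedSpace E M] [Group M] [LieGroup 𝓘(ℝ, E) ∞ M]

/-- Restricting `m^* η = pr₁^* η + pr₂^* η` to the slices `{g} × G` and `G × {g}` shows that a
primitive form of positive degree is bi-invariant. -/
theorem DiffForm.IsPrimitive.isBiInvariant {k : ℕ} {η : DiffForm (k + 1) E M}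
    (hη : η.IsPrimitive) : η.IsBiInvariant := by
  have hzero : ∀ θ : E [⋀^Fin (k + 1)]→L[ℝ] ℝ, θ.compContinuousLinearMap (0 : E →L[ℝ] E) = 0 :=
    fun θ => by
      ext v
      exact θ.map_coord_zero 0 rfl
  have hm : MDifferentiable (𝓘(ℝ, E).prod 𝓘(ℝ, E)) 𝓘(ℝ, E) (fun q : M × M => q.1 * q.2) :=
    (contMDiff_mul 𝓘(ℝ, E) ∞).mdifferentiable (by simp)
  have hcomp : ∀ (ι : M → M × M), MDifferentiable 𝓘(ℝ, E) (𝓘(ℝ, E).prod 𝓘(ℝ, E)) ι →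
      ∀ x, η.pullback 𝓘(ℝ, E) (fun h => (ι h).1 * (ι h).2) x =
        η.pullback 𝓘(ℝ, E) (fun h => (ι h).1) x + η.pullback 𝓘(ℝ, E) (fun h => (ι h).2) x := by
    intro ι hι x
    have h1 := mfderiv_comp x (hm (ι x)) (hι x)
    have h2 := mfderiv_comp x (mdifferentiableAt_fst (x := ι x) (I := 𝓘(ℝ, E)) (I' := 𝓘(ℝ, E)))
      (hι x)
    have h3 := mfderiv_comp x (mdifferentiableAt_snd (x := ι x) (I := 𝓘(ℝ, E)) (I' := 𝓘(ℝ, E)))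
      (hι x)
    have h4 := congrArg (fun θ : (E × E) [⋀^Fin (k + 1)]→L[ℝ] ℝ => θ.compContinuousLinearMap
      (mfderiv 𝓘(ℝ, E) (𝓘(ℝ, E).prod 𝓘(ℝ, E)) ι x : E →L[ℝ] E × E)) (hη (ι x))
    simp only [DiffForm.pullback]
    rw [show mfderiv 𝓘(ℝ, E) 𝓘(ℝ, E) (fun h => (ι h).1 * (ι h).2) x = _ from h1,
      show mfderiv 𝓘(ℝ, E) 𝓘(ℝ, E) (fun h => (ι h).1) x = _ from h2,
      show mfderiv 𝓘(ℝ, E) 𝓘(ℝ, E) (fun h => (ι h).2) x = _ from h3]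
    exact h4
  have hconst : ∀ g x : M, η.pullback 𝓘(ℝ, E) (fun _ : M => g) x = 0 := fun g x => by
    rw [DiffForm.pullback, mfderiv_const]
    exact hzero _
  have hid : ∀ x : M, η.pullback 𝓘(ℝ, E) (fun h : M => h) x = η.val x := fun x => by
    have : mfderiv 𝓘(ℝ, E) 𝓘(ℝ, E) (fun h : M => h) x = ContinuousLinearMap.id ℝ E := mfderiv_id
    rw [DiffForm.pullback, this]
    rfl
  intro g x
  constructor
  · have := hcomp (fun h => (g, h)) (mdifferentiable_const.prodMk mdifferentiable_id) x
    rwa [hconst, hid, zero_add] at this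
  · have := hcomp (fun h => (h, g)) (mdifferentiable_id.prodMk mdifferentiable_const) x
    rwa [hconst, hid, add_zero] at this

end Primitive

/-! ### Pullbacks of closed 1-forms along smooth maps from vector spaces -/

section Closed

open selfAdjoint

variable {H : Type u} [NormedAddCommGroup H] [InnerProductSpace ℂ H] [CompleteSpace H]
  {V : Type*} [NormedAddCommGroup V] [NormedSpace ℝ V]

/-- A map into the unitary group that is smooth as a map into the bounded operators is smooth in
the exponential charts. -/
theorem contDiffAt_chartAt_unitary {σ : V → UGroup H} {q : V}
    (hσ : ContDiffAt ℝ ∞ (fun t => (σ t : BddOp H)) q) :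
    ContDiffAt ℝ ∞ (fun t => chartAt (LieU H) (σ q) (σ t)) q := by
  let Q := unitaryExp (BddOp H)
  have harg : ∀ g ∈ Q.expHomeo.target, Q.expHomeo.symm g = Unitary.argSelfAdjoint g := by
    intro g hg
    obtain ⟨x, hx, hxg⟩ : Q.expHomeo.symm g ∈ Q.lin '' Metric.ball 0 (1 / 2) :=
      Q.expHomeo.map_target hg
    have h1 : Q.expMap (Q.lin x) = g := by
      rw [hxg, ← Q.expHomeo_apply, Q.expHomeo.right_inv hg]
    have h2 : expUnitary x = g := by rw [← h1, Q.expMap_lin]; rfl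
    have h3 : ‖x‖ < 1 / 2 := by simpa using hx
    rw [← hxg, ← h2, argSelfAdjoint_expUnitary (h3.trans (by linarith [Real.pi_gt_three]))]
    rfl
  have hw : ContDiffAt ℝ ∞ (fun t => (((σ q)⁻¹ * σ t : UGroup H) : BddOp H)) q :=
    contDiffAt_const.mul hσ
  have h1 := contDiffAt_argSelfAdjoint (fun t => (σ q)⁻¹ * σ t) q hw 0 (by simp) (by simp)
  refine h1.congr_of_eventuallyEq ?_
  have hc : ContinuousAt (fun t => (σ q)⁻¹ * σ t) q := by
    rw [Topology.IsInducing.subtypeVal.continuousAt_iff]; exact hw.continuousAt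
  have h2 : ∀ᶠ t in 𝓝 q, (σ q)⁻¹ * σ t ∈ Q.expHomeo.target :=
    hc.eventually (Q.expHomeo.open_target.mem_nhds (by simpa using Q.one_mem))
  filter_upwards [h2] with t ht
  exact harg _ ht

theorem continuousAt_unitary {σ : V → UGroup H} {q : V}
    (hσ : ContDiffAt ℝ ∞ (fun t => (σ t : BddOp H)) q) : ContinuousAt σ q := by
  rw [Topology.IsInducing.subtypeVal.continuousAt_iff]; exact hσ.continuousAt

theorem mdifferentiableAt_unitary {σ : V → UGroup H} {q : V}
    (hσ : ContDiffAt ℝ ∞ (fun t => (σ t : BddOp H)) q) :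
    MDifferentiableAt 𝓘(ℝ, V) 𝓘(ℝ, LieU H) σ q := by
  rw [mdifferentiableAt_iff]
  exact ⟨continuousAt_unitary hσ,
    ((contDiffAt_chartAt_unitary hσ).differentiableAt (by simp)).differentiableWithinAt⟩

/-- In the chart around `σ q`, the pullback of a form along `σ` is the pullback of its local
representative. -/
theorem pullback_eventuallyEq {k : ℕ} (η : DiffForm k (LieU H) (UGroup H)) {σ : V → UGroup H}
    (hσ : ContDiff ℝ ∞ (fun t => (σ t : BddOp H))) (q : V) :
    ∀ᶠ t in 𝓝 q, η.pullback 𝓘(ℝ, V) σ t =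
      (localForm η.val (σ q) (chartAt (LieU H) (σ q) (σ t))).compContinuousLinearMap
        (fderiv ℝ (fun t => chartAt (LieU H) (σ q) (σ t)) t) := by
  let φ := chartAt (LieU H) (σ q)
  let ev : UGroup H → LieU H [⋀^Fin k]→L[ℝ] ℝ := η.val
  have hc : Continuous σ := continuous_iff_continuousAt.2 fun t =>
    continuousAt_unitary hσ.contDiffAt
  have hopen : IsOpen (σ ⁻¹' φ.source) := φ.open_source.preimage hc
  filter_upwards [hopen.mem_nhds (mem_chart_source (LieU H) (σ q))] with t ht
  have hφ : MDifferentiableAt 𝓘(ℝ, LieU H) 𝓘(ℝ, LieU H) φ (σ t) :=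
    mdifferentiableAt_atlas (chart_mem_atlas _ _) ht
  have hφs : MDifferentiableAt 𝓘(ℝ, LieU H) 𝓘(ℝ, LieU H) φ.symm (φ (σ t)) :=
    mdifferentiableAt_atlas_symm (chart_mem_atlas _ _) (φ.map_source ht)
  have hσt := mdifferentiableAt_unitary (hσ.contDiffAt (x := t))
  have hY : MDifferentiableAt 𝓘(ℝ, V) 𝓘(ℝ, LieU H) (fun t => φ (σ t)) t := hφ.comp t hσt
  have h1 : mfderiv 𝓘(ℝ, V) 𝓘(ℝ, LieU H) σ t =
      (mfderiv 𝓘(ℝ, LieU H) 𝓘(ℝ, LieU H) φ.symm (φ (σ t)) : LieU H →L[ℝ] LieU H).comp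
        (fderiv ℝ (fun t => φ (σ t)) t) := by
    have h2 := HasMFDerivAt.comp (f := fun t => φ (σ t)) t hφs.hasMFDerivAt hY.hasMFDerivAt
    have h3 : σ =ᶠ[𝓝 t] φ.symm ∘ fun t => φ (σ t) := by
      filter_upwards [hopen.mem_nhds ht] with s hs
      exact (φ.left_inv hs).symm
    exact h3.mfderiv_eq.trans (h2.mfderiv.trans (by rw [mfderiv_eq_fderiv]; rfl))
  show (ev (σ t)).compContinuousLinearMap _ = ((ev (φ.symm (φ (σ t)))).compContinuousLinearMap
    _).compContinuousLinearMap _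
  rw [φ.left_inv ht, h1]
  rfl

/-- The pullback of a closed 1-form on the unitary group along a smooth map is exact when the
source is a vector space, by the Poincaré lemma. -/
theorem exists_primitive_pullback {A : DiffForm 1 (LieU H) (UGroup H)}
    (hA : ∀ u, A.extDer u = 0) {σ : V → UGroup H}
    (hσ : ContDiff ℝ ∞ (fun t => (σ t : BddOp H))) :
    ∃ (b : V → V →L[ℝ] ℝ) (f : V → ℝ), Continuous b ∧ (∀ q, HasFDerivAt f (b q) q) ∧
      ∀ q v, b q v = A.pullback 𝓘(ℝ, V) σ q (fun _ => v) := by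
  let β : V → V [⋀^Fin 1]→L[ℝ] ℝ := fun q => A.pullback 𝓘(ℝ, V) σ q
  let J : V [⋀^Fin 1]→L[ℝ] ℝ →L[ℝ] (V →L[ℝ] ℝ) := (ContinuousAlternatingMap.ofSubsingletonLIE
    (𝕜 := ℝ) (E := V) (F := ℝ) (0 : Fin 1)).symm.toContinuousLinearEquiv.toContinuousLinearMap
  let b : V → V →L[ℝ] ℝ := fun q => J (β q)
  have hY : ∀ q, ContDiffAt ℝ ∞ (fun t => chartAt (LieU H) (σ q) (σ t)) q := fun q =>
    contDiffAt_chartAt_unitary hσ.contDiffAt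
  have hloc : ∀ q, DifferentiableAt ℝ (localForm A.val (σ q)) (chartAt (LieU H) (σ q) (σ q)) :=
    fun q => ((A.smooth (σ q)).contDiffAt ((chartAt (LieU H) (σ q)).open_target.mem_nhds
      ((chartAt (LieU H) (σ q)).map_source (mem_chart_source _ _)))).differentiableAt (by simp)
  have hβd : ∀ q, DifferentiableAt ℝ β q := fun q => by
    refine DifferentiableAt.congr_of_eventuallyEq ?_ (pullback_eventuallyEq A hσ q)
    refine DifferentiableAt.continuousAlternatingMapCompContinuousLinearMap ?_ ?_
    · exact DifferentiableAt.comp (g := localForm A.val (σ q)) q (hloc q)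
        ((hY q).differentiableAt (by simp))
    · exact ((hY q).fderiv_right (m := 1) (by norm_cast)).differentiableAt (by simp)
  -- At `q` itself the map `σ` hits the centre of the chart, where `extDer` is computed.
  have hβ : ∀ q, extDeriv β q = 0 := fun q => by
    have hβe : β =ᶠ[𝓝 q] _ := pullback_eventuallyEq A hσ q
    have hpb := extDeriv_pullback (f := fun t => chartAt (LieU H) (σ q) (σ t)) (hloc q)
      ((hY q).of_le (m := 2) (by norm_cast)) (by simp)
    rw [hβe.extDeriv_eq, hpb]
    have h1 := hA (σ q)
    have hs : Function.Surjective (mfderiv 𝓘(ℝ, LieU H) 𝓘(ℝ, LieU H)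
        (chartAt (LieU H) (σ q)) (σ q)) :=
      (mdifferentiable_chart (I := 𝓘(ℝ, LieU H)) (σ q)).mfderiv_surjective
        (mem_chart_source (LieU H) (σ q))
    have h2 : extDeriv (localForm A.val (σ q)) (chartAt (LieU H) (σ q) (σ q)) = 0 := by
      ext v
      choose r hr using hs
      have h3 := congrArg (fun θ : LieU H [⋀^Fin 2]→L[ℝ] ℝ => θ fun i => r (v i)) h1
      refine Eq.trans ?_ h3
      exact congrArg (extDeriv (localForm A.val (σ q)) (chartAt (LieU H) (σ q) (σ q)))
        (funext fun i => (hr (v i)).symm)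
    rw [h2]
    rfl
  have hJ : ∀ θ : V [⋀^Fin 1]→L[ℝ] ℝ, ∀ v, J θ v = θ fun _ => v := fun θ v => rfl
  have hbd : Differentiable ℝ b := fun q => J.differentiable.differentiableAt.comp q (hβd q)
  obtain ⟨f, hf⟩ := convex_univ.exists_forall_hasFDerivAt_of_fderiv_symmetric isOpen_univ
    hbd.differentiableOn (by
      intro q _ x y
      have hev : ∀ x y, fderiv ℝ (fun p => β p fun _ => y) q x = fderiv ℝ b q x y := fun x y => by
        have h1 : HasFDerivAt (fun p => b p y) _ q :=
          (hbd q).hasFDerivAt.clm_apply (hasFDerivAt_const y q)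
        rw [show (fun p => β p fun _ => y) = fun p => b p y from rfl, h1.fderiv]
        simp
      have h2 := extDeriv_apply (hβd q) ![x, y]
      rw [hβ q, Fin.sum_univ_two] at h2
      have e0 : Fin.removeNth 0 ![x, y] = fun _ => y := by
        funext i; fin_cases i; rfl
      have e1 : Fin.removeNth 1 ![x, y] = fun _ => x := by
        funext i; fin_cases i; rfl
      rw [e0, e1] at h2
      simp only [Fin.val_zero, Fin.val_one, pow_zero, pow_one, one_smul, neg_smul,
        Matrix.cons_val_zero, Matrix.cons_val_one, hev] at h2
      exact (eq_of_sub_eq_zero ((sub_eq_add_neg _ _).trans h2.symm)))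
  exact ⟨b, f, hbd.continuous, fun q => hf q trivial, fun q v => hJ _ v⟩

end Closed

/-! ### Integrals of closed 1-forms over loops of unitaries -/

section Loops

variable {H : Type u} [NormedAddCommGroup H] [InnerProductSpace ℂ H] [CompleteSpace H]

/-- The integral of the 1-form `A` over the curve `γ`, for parameters from `0` to `2π`. -/
noncomputable def loopIntegral (A : DiffForm 1 (LieU H) (UGroup H)) (γ : ℝ → UGroup H) : ℝ :=
  ∫ t in (0 : ℝ)..(2 * Real.pi), A.pullback 𝓘(ℝ, ℝ) γ t (fun _ => (1 : ℝ))

theorem pullback_comp_apply {V W : Type*} [NormedAddCommGroup V] [NormedSpace ℝ V]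
    [NormedAddCommGroup W] [NormedSpace ℝ W]
    (A : DiffForm 1 (LieU H) (UGroup H)) {σ : V → UGroup H}
    (hσ : ContDiff ℝ ∞ (fun t => (σ t : BddOp H))) {c : W → V} {D : W →L[ℝ] V} {t : W}
    (hc : HasFDerivAt c D t) (w : W) :
    A.pullback 𝓘(ℝ, W) (fun s => σ (c s)) t (fun _ => w) =
      A.pullback 𝓘(ℝ, V) σ (c t) (fun _ => D w) := by
  have h := HasMFDerivAt.comp t (mdifferentiableAt_unitary (hσ.contDiffAt (x := c t))).hasMFDerivAt
    hc.hasMFDerivAt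
  have h1 : mfderiv 𝓘(ℝ, W) 𝓘(ℝ, LieU H) (fun s => σ (c s)) t = _ := h.mfderiv
  simp only [DiffForm.pullback]
  rw [h1]
  rfl

/-- The integral of a closed 1-form over a loop is invariant under smooth free homotopies. -/
theorem loopIntegral_homotopy {A : DiffForm 1 (LieU H) (UGroup H)}
    (hA : ∀ u, A.extDer u = 0) {σ : ℝ × ℝ → UGroup H}
    (hσ : ContDiff ℝ ∞ (fun t => (σ t : BddOp H)))
    (hper : ∀ s, σ (s, 2 * Real.pi) = σ (s, 0)) (s s' : ℝ) :
    loopIntegral A (fun t => σ (s, t)) = loopIntegral A (fun t => σ (s', t)) := by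
  obtain ⟨b, f, hb, hf, hbA⟩ := exists_primitive_pullback hA hσ
  have hcol : ∀ s t, HasFDerivAt (fun t : ℝ => (s, t)) (ContinuousLinearMap.inr ℝ ℝ ℝ) t :=
    fun s t => (hasFDerivAt_const s t).prodMk (hasFDerivAt_id t)
  have hrow : ∀ s t, HasFDerivAt (fun s : ℝ => (s, t)) (ContinuousLinearMap.inl ℝ ℝ ℝ) s :=
    fun s t => (hasFDerivAt_id s).prodMk (hasFDerivAt_const t s)
  have hdt : ∀ s t, HasDerivAt (fun t => f (s, t)) (b (s, t) (0, 1)) t := fun s t =>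
    (hf (s, t)).comp_hasDerivAt t (hcol s t).hasDerivAt
  have hds : ∀ s t, HasDerivAt (fun s => f (s, t)) (b (s, t) (1, 0)) s := fun s t =>
    HasFDerivAt.comp_hasDerivAt (f := fun s => (s, t)) s (hf (s, t)) (hrow s t).hasDerivAt
  have hI : ∀ s, loopIntegral A (fun t => σ (s, t)) = f (s, 2 * Real.pi) - f (s, 0) := fun s => by
    rw [← intervalIntegral.integral_eq_sub_of_hasDerivAt (fun t _ => hdt s t)]
    · refine intervalIntegral.integral_congr fun t _ => ?_
      rw [hbA]
      exact pullback_comp_apply A hσ (hcol s t) 1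
    · have : Continuous fun t => b (s, t) (0, 1) :=
        (hb.comp (continuous_const.prodMk continuous_id)).clm_apply continuous_const
      exact this.intervalIntegrable _ _
  -- The top and bottom edges of the homotopy are the same curve.
  have hb2 : ∀ s, b (s, 2 * Real.pi) (1, 0) = b (s, 0) (1, 0) := fun s => by
    rw [hbA, hbA]
    have h1 := pullback_comp_apply A hσ (hrow s (2 * Real.pi)) 1
    have h2 := pullback_comp_apply A hσ (hrow s 0) 1
    simp only [hper] at h1
    exact h1.symm.trans h2
  have hd : ∀ s, HasDerivAt (fun s => f (s, 2 * Real.pi) - f (s, 0)) 0 s := fun s => by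
    have := (hds s (2 * Real.pi)).sub (hds s 0)
    rwa [hb2, sub_self] at this
  rw [hI, hI]
  exact is_const_of_deriv_eq_zero (fun s => (hd s).differentiableAt) (fun s => (hd s).deriv) s s'

/-- Running twice along a loop doubles the integral. -/
theorem loopIntegral_two_mul (A : DiffForm 1 (LieU H) (UGroup H)) {γ : ℝ → UGroup H}
    (hγ : ContDiff ℝ ∞ (fun t => (γ t : BddOp H))) (hper : ∀ t, γ (t + 2 * Real.pi) = γ t)
    (hint : Continuous fun t => A.pullback 𝓘(ℝ, ℝ) γ t (fun _ => (1 : ℝ))) :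
    loopIntegral A (fun t => γ (2 * t)) = 2 * loopIntegral A γ := by
  let a : ℝ → ℝ := fun t => A.pullback 𝓘(ℝ, ℝ) γ t (fun _ => (1 : ℝ))
  have ha : Function.Periodic a (2 * Real.pi) := fun t => by
    have h := pullback_comp_apply A hγ ((hasFDerivAt_id t).add_const (2 * Real.pi)) (1 : ℝ)
    simp only [id, hper] at h
    exact h.symm
  have h2 : ∀ t, A.pullback 𝓘(ℝ, ℝ) (fun t => γ (2 * t)) t (fun _ => (1 : ℝ)) = 2 * a (2 * t) :=
    fun t => by
    have h := pullback_comp_apply A hγ ((hasFDerivAt_id t).const_mul 2) (1 : ℝ)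
    refine h.trans ?_
    let θ : ℝ [⋀^Fin 1]→L[ℝ] ℝ := A.pullback 𝓘(ℝ, ℝ) γ (2 * t)
    have h3 := θ.toMultilinearMap.map_smul_univ (fun _ => (2 : ℝ)) (fun _ => 1)
    have h4 : θ (fun _ => 2) = 2 * θ (fun _ => 1) := by simpa using h3
    show θ (fun _ => ((2 : ℝ) • ContinuousLinearMap.id ℝ ℝ) 1) = 2 * θ (fun _ => 1)
    rw [← h4]
    simp
  have hi : ∀ x y, IntervalIntegrable a MeasureTheory.volume x y := fun x y =>
    hint.intervalIntegrable x y
  calc loopIntegral A (fun t => γ (2 * t)) = ∫ t in (0 : ℝ)..(2 * Real.pi), 2 * a (2 * t) :=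
        intervalIntegral.integral_congr fun t _ => h2 t
    _ = ∫ t in (0 : ℝ)..(2 * Real.pi) + 2 * Real.pi, a t := by
        rw [intervalIntegral.integral_const_mul, intervalIntegral.mul_integral_comp_mul_left]
        congr 1 <;> ring
    _ = (∫ t in (0 : ℝ)..(2 * Real.pi), a t) +
          ∫ t in (2 * Real.pi)..(2 * Real.pi) + 2 * Real.pi, a t :=
        (intervalIntegral.integral_add_adjacent_intervals (hi _ _) (hi _ _)).symm
    _ = (∫ t in (0 : ℝ)..(2 * Real.pi), a t) + ∫ t in (0 : ℝ)..(2 * Real.pi), a t := by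
        rw [ha.intervalIntegral_add_eq (2 * Real.pi) 0, zero_add]
    _ = 2 * loopIntegral A γ := (two_mul _).symm

/-- A connection form takes the value `1` on the velocity of `t ↦ e^{it}` at all times, so its
integral over this loop is `2π`. -/
theorem IsConnection.loopIntegral_scalar {A : DiffForm 1 (LieU H) (UGroup H)}
    (hA : IsConnection A) :
    loopIntegral A (fun t => scalarUnitary (BddOp H) (Circle.exp t)) = 2 * Real.pi := by
  let γ : ℝ → UGroup H := fun t => scalarUnitary (BddOp H) (Circle.exp t)
  have hs : ∀ u : UGroup H, ContDiff ℝ ∞ (fun t : ℝ =>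
      ((u * scalarUnitary (BddOp H) (Circle.exp t) : UGroup H) : BddOp H)) := fun u => by
    have : ∀ t : ℝ, ((u * scalarUnitary (BddOp H) (Circle.exp t) : UGroup H) : BddOp H) =
        (u : BddOp H) * (Complex.exp (t * Complex.I) • (1 : BddOp H)) := fun t => by
      simp [scalarUnitary]
    simp only [this]
    have h1 : ContDiff ℝ ∞ fun t : ℝ => Complex.exp (t * Complex.I) :=
      ((Complex.ofRealCLM.contDiff).mul contDiff_const).cexp
    exact contDiff_const.mul (h1.smul contDiff_const)
  have h : ∀ t, A.pullback 𝓘(ℝ, ℝ) γ t (fun _ => (1 : ℝ)) = 1 := fun t => by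
    have h1 := pullback_comp_apply A (hs (γ t)) ((hasFDerivAt_id t).sub_const t) (1 : ℝ)
    have h2 : (fun s => γ t * scalarUnitary (BddOp H) (Circle.exp (id s - t))) = γ := by
      funext s
      simp only [γ, ← map_mul, ← Circle.exp_add, id]
      congr 2
      ring
    rw [h2] at h1
    refine h1.trans ?_
    have h3 : id t - t = 0 := sub_self t
    rw [h3]
    exact hA.vertical (γ t)
  show ∫ t in (0 : ℝ)..(2 * Real.pi), A.pullback 𝓘(ℝ, ℝ) γ t (fun _ => (1 : ℝ)) = _
  simp only [h]
  simp

end Loops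

/-! ### The loops of unitaries attached to projections -/

section Phase

variable {B : Type u} [CStarAlgebra B]

/-- The unitary `z p + (1 - p)` for a projection `p` and `z ∈ U(1)`. -/
noncomputable def phaseUnitary {p : B} (hp : IsStarProjection p) (z : Circle) : unitary B :=
  ⟨1 + ((z : ℂ) - 1) • p, by
    have h1 : starRingEnd ℂ (z : ℂ) * z = 1 := by
      rw [← Complex.normSq_eq_conj_mul_self, Circle.normSq_coe, Complex.ofReal_one]
    have h2 : (z : ℂ) * starRingEnd ℂ (z : ℂ) = 1 := by rw [mul_comm, h1]
    have hmul : ∀ a b : ℂ, a * b = 1 → (1 + (a - 1) • p) * (1 + (b - 1) • p) = 1 := fun a b hab => by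
      have hpp : p * p = p := hp.isIdempotentElem
      have h3 : (a - 1) + (b - 1) + (a - 1) * (b - 1) = 0 := by linear_combination hab
      calc _ = 1 + ((a - 1) + (b - 1) + (a - 1) * (b - 1)) • p := by
            simp only [mul_add, add_mul, mul_one, one_mul, smul_mul_smul_comm, hpp]
            module
        _ = 1 := by rw [h3, zero_smul, add_zero]
    have hstar : star (1 + ((z : ℂ) - 1) • p) = 1 + (starRingEnd ℂ (z : ℂ) - 1) • p := by
      simp only [star_add, star_one, star_smul, hp.isSelfAdjoint.star_eq, Complex.star_def, map_sub,
        map_one]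
    rw [Unitary.mem_iff, hstar]
    exact ⟨hmul _ _ h1, hmul _ _ h2⟩⟩

theorem coe_phaseUnitary {p : B} (hp : IsStarProjection p) (z : Circle) :
    (phaseUnitary hp z : B) = 1 + ((z : ℂ) - 1) • p := rfl

theorem phaseUnitary_mul {p : B} (hp : IsStarProjection p) (z z' : Circle) :
    phaseUnitary hp (z * z') = phaseUnitary hp z * phaseUnitary hp z' := by
  have hpp : p * p = p := hp.isIdempotentElem
  ext1
  simp only [coe_phaseUnitary, Submonoid.coe_mul, Circle.coe_mul, mul_add, add_mul, mul_one,
    one_mul, smul_mul_smul_comm, hpp]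
  module

theorem phaseUnitary_one_right {p : B} (hp : IsStarProjection p) : phaseUnitary hp 1 = 1 := by
  ext1; simp [coe_phaseUnitary]

theorem phaseUnitary_mul_phaseUnitary {p q : B} (hp : IsStarProjection p) (hq : IsStarProjection q)
    (hpq : IsStarProjection (p + q)) (h : q * p = 0) (z : Circle) :
    phaseUnitary hq z * phaseUnitary hp z = phaseUnitary hpq z := by
  ext1
  simp only [coe_phaseUnitary, Submonoid.coe_mul, mul_add, add_mul, mul_one, one_mul,
    smul_mul_smul_comm, h, smul_zero, smul_add]
  abel

theorem contDiff_phaseUnitary {V : Type*} [NormedAddCommGroup V] [NormedSpace ℝ V] {p : B}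
    (hp : IsStarProjection p) {c : V → ℝ} (hc : ContDiff ℝ ∞ c) :
    ContDiff ℝ ∞ fun t => (phaseUnitary hp (Circle.exp (c t)) : B) := by
  simp only [coe_phaseUnitary, Circle.coe_exp]
  have h1 : ContDiff ℝ ∞ fun t => Complex.exp (c t * Complex.I) :=
    ((Complex.ofRealCLM.contDiff.comp hc).mul contDiff_const).cexp
  exact contDiff_const.add ((h1.sub contDiff_const).smul contDiff_const)

theorem ContDiff.unitary_inv {V : Type*} [NormedAddCommGroup V] [NormedSpace ℝ V]
    {σ : V → unitary B} (hσ : ContDiff ℝ ∞ fun t => (σ t : B)) :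
    ContDiff ℝ ∞ fun t => (((σ t)⁻¹ : unitary B) : B) :=
  ((starL' ℝ : B ≃L[ℝ] B) : B →L[ℝ] B).contDiff.comp hσ

theorem isStarProjection_mul_star {y : B} (hy : star y * y = 1) :
    IsStarProjection (y * star y) where
  isIdempotentElem := by
    show y * star y * (y * star y) = y * star y
    rw [mul_assoc, ← mul_assoc (star y), hy, one_mul]
  isSelfAdjoint := by
    show star (y * star y) = y * star y
    rw [star_mul, star_star]

/-- A path of unitaries that starts at `1` and ends at the symmetry that exchanges the orthogonal
ranges of two isometries. -/
theorem exists_rotation {y z : B} (hy : star y * y = 1) (hz : star z * z = 1)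
    (hyz : star y * z = 0) :
    ∃ R : ℝ → unitary B, (ContDiff ℝ ∞ fun s => (R s : B)) ∧ R 0 = 1 ∧
      (R Real.pi : B) * (y * star y) * star (R Real.pi : B) = z * star z := by
  have hzy : star z * y = 0 := by simpa using congrArg star hyz
  let w : B := z * star y + y * star z + (1 - y * star y - z * star z)
  have hyy : ∀ x, star y * (y * x) = x := fun x => by rw [← mul_assoc, hy, one_mul]
  have hzz : ∀ x, star z * (z * x) = x := fun x => by rw [← mul_assoc, hz, one_mul]
  have hyz' : ∀ x, star y * (z * x) = 0 := fun x => by rw [← mul_assoc, hyz, zero_mul]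
  have hzy' : ∀ x, star z * (y * x) = 0 := fun x => by rw [← mul_assoc, hzy, zero_mul]
  have hws : star w = w := by
    simp only [w, star_add, star_sub, star_mul, star_star, star_one]
    abel
  have hww : w * w = 1 := by
    simp only [w, mul_add, add_mul, mul_sub, sub_mul, mul_assoc, hyy, hzz, hyz', hzy', mul_one,
      one_mul, mul_zero]
    abel
  have hwy : w * y = z := by
    simp only [w, add_mul, sub_mul, mul_assoc, hy, hzy, mul_one, one_mul, mul_zero]
    abel
  -- The symmetry `w` is `-1` on the range of the projection `(1 - w) / 2` and `1` on its kernel, so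
  -- it is the value at `-1 = e^{iπ}` of the corresponding phase rotation.
  have he : IsStarProjection ((1 / 2 : ℂ) • (1 - w)) :=
    { isIdempotentElem := by
        show (1 / 2 : ℂ) • (1 - w) * (1 / 2 : ℂ) • (1 - w) = (1 / 2 : ℂ) • (1 - w)
        rw [smul_mul_smul_comm, mul_sub, mul_one, sub_mul, one_mul, hww]
        module
      isSelfAdjoint := by
        show star ((1 / 2 : ℂ) • (1 - w)) = (1 / 2 : ℂ) • (1 - w)
        simp [hws] }
  have hpi : (phaseUnitary he (Circle.exp Real.pi) : B) = w := by
    rw [coe_phaseUnitary, Circle.coe_exp, Complex.exp_pi_mul_I]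
    module
  refine ⟨fun s => phaseUnitary he (Circle.exp s), contDiff_phaseUnitary he contDiff_id, ?_, ?_⟩
  · simp only [Circle.exp_zero, phaseUnitary_one_right]
  · have h1 : star y * w = star z := by
      have := congrArg star hwy
      rwa [star_mul, hws] at this
    rw [hpi, hws, ← mul_assoc, hwy, mul_assoc, h1]

theorem conj_phaseUnitary {p q : B} (hp : IsStarProjection p) (hq : IsStarProjection q)
    (u : unitary B) (h : (u : B) * p * star (u : B) = q) (z : Circle) :
    u * phaseUnitary hp z * u⁻¹ = phaseUnitary hq z := by
  ext1
  have hu : (u : B) * star (u : B) = 1 := Unitary.coe_mul_star_self u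
  show (u : B) * (1 + ((z : ℂ) - 1) • p) * star (u : B) = 1 + ((z : ℂ) - 1) • q
  rw [mul_add, add_mul, mul_one, hu, mul_smul_comm, smul_mul_assoc, h]

end Phase

/-! ### Connections are not flat -/

section Curvature

variable {H : Type u} [NormedAddCommGroup H] [InnerProductSpace ℂ H] [CompleteSpace H]
  {A : DiffForm 1 (LieU H) (UGroup H)}

/-- The integral of `A` over the loop `t ↦ e^{it} p + (1 - p)`. -/
noncomputable def phaseIntegral (A : DiffForm 1 (LieU H) (UGroup H)) {p : BddOp H}
    (hp : IsStarProjection p) : ℝ :=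
  loopIntegral A fun t => phaseUnitary hp (Circle.exp t)

theorem circle_exp_two_pi_add (t : ℝ) : Circle.exp (t + 2 * Real.pi) = Circle.exp t :=
  Circle.periodic_exp t

/-- The loops of two orthogonal equivalent projections are homotopic, by conjugating with a
rotation of the one range into the other. -/
theorem phaseIntegral_eq (hA : ∀ u, A.extDer u = 0) {y z : BddOp H} (hy : star y * y = 1)
    (hz : star z * z = 1) (hyz : star y * z = 0) :
    phaseIntegral A (isStarProjection_mul_star hy) =
      phaseIntegral A (isStarProjection_mul_star hz) := by
  obtain ⟨R, hR, hR0, hRpi⟩ := exists_rotation hy hz hyz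
  let p := isStarProjection_mul_star hy
  let q := isStarProjection_mul_star hz
  let σ : ℝ × ℝ → UGroup H := fun x => R x.1 * phaseUnitary p (Circle.exp x.2) * (R x.1)⁻¹
  have hR1 : ContDiff ℝ ∞ fun x : ℝ × ℝ => (R x.1 : BddOp H) := hR.comp contDiff_fst
  have hσ : ContDiff ℝ ∞ fun x => (σ x : BddOp H) :=
    (hR1.mul (contDiff_phaseUnitary p contDiff_snd)).mul hR1.unitary_inv
  have h := loopIntegral_homotopy hA hσ (fun s => by simp [σ]) 0 Real.pi
  have h0 : (fun t => σ (0, t)) = fun t => phaseUnitary p (Circle.exp t) := by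
    funext t; simp [σ, hR0]
  have h1 : (fun t => σ (Real.pi, t)) = fun t => phaseUnitary q (Circle.exp t) := by
    funext t; exact conj_phaseUnitary p q _ hRpi _
  rwa [h0, h1] at h

/-- Rotating the loop of one projection into that of the other turns the loop of their sum into
a loop that is run twice. -/
theorem phaseIntegral_add (hA : ∀ u, A.extDer u = 0) {y z : BddOp H} (hy : star y * y = 1)
    (hz : star z * z = 1) (hyz : star y * z = 0)
    (hs : IsStarProjection (y * star y + z * star z)) :
    phaseIntegral A hs = 2 * phaseIntegral A (isStarProjection_mul_star hz) := by
  obtain ⟨R, hR, hR0, hRpi⟩ := exists_rotation hy hz hyz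
  have hzy : star z * y = 0 := by simpa using congrArg star hyz
  let p := isStarProjection_mul_star hy
  let q := isStarProjection_mul_star hz
  let σ : ℝ × ℝ → UGroup H := fun x => phaseUnitary q (Circle.exp x.2) *
    (R x.1 * phaseUnitary p (Circle.exp x.2) * (R x.1)⁻¹)
  have hR1 : ContDiff ℝ ∞ fun x : ℝ × ℝ => (R x.1 : BddOp H) := hR.comp contDiff_fst
  have hσ : ContDiff ℝ ∞ fun x => (σ x : BddOp H) :=
    (contDiff_phaseUnitary q contDiff_snd).mul
      ((hR1.mul (contDiff_phaseUnitary p contDiff_snd)).mul hR1.unitary_inv)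
  have h := loopIntegral_homotopy hA hσ (fun s => by simp [σ]) 0 Real.pi
  have h0 : (fun t => σ (0, t)) = fun t => phaseUnitary hs (Circle.exp t) := by
    funext t
    simp only [σ, hR0, one_mul, inv_one, mul_one]
    refine phaseUnitary_mul_phaseUnitary p q hs ?_ _
    rw [mul_assoc, ← mul_assoc (star z), hzy, zero_mul, mul_zero]
  have h1 : (fun t => σ (Real.pi, t)) = fun t => phaseUnitary q (Circle.exp (2 * t)) := by
    funext t
    simp only [σ]
    rw [conj_phaseUnitary p q _ hRpi, ← phaseUnitary_mul, ← Circle.exp_add, two_mul]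
  rw [h0, h1] at h
  have hq := contDiff_phaseUnitary q (contDiff_id (E := ℝ))
  obtain ⟨b, f, hb, -, hbA⟩ := exists_primitive_pullback hA hq
  refine h.trans (loopIntegral_two_mul A (γ := fun t => phaseUnitary q (Circle.exp t)) hq
    (fun t => by rw [circle_exp_two_pi_add]) ?_)
  exact (hb.clm_apply continuous_const).congr fun t => hbA t 1

/-- A connection on `U(H) → PU(H)` is not flat. If `J p` denotes the integral over the loop of the
projection `p`, then `J 1 = 2 J (w w*)` and `J (w w*) = 2 J (w w w* w*)`, while
`J (w w*) = J (v v*) = J (w w w* w*)`. Hence `J 1 = 0`, but the connection has `J 1 = 2π`. -/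
theorem IsConnection.not_closed (hH : ¬ FiniteDimensional ℂ H) (hA : IsConnection A) :
    ¬ ∀ u, A.extDer u = 0 := by
  intro hc
  obtain ⟨v, w, hv, hw, hvw, hsum⟩ := exists_cuntz_pair hH
  have hiso : ∀ x y : BddOp H, star x * x = 1 → star y * y = 1 → star (x * y) * (x * y) = 1 :=
    fun x y hx hy => by rw [star_mul, mul_assoc, ← mul_assoc _ x, hx, one_mul, hy]
  have hwv := hiso w v hw hv
  have hww := hiso w w hw hw
  have horth : star (w * v) * (w * w) = 0 := by
    rw [star_mul, mul_assoc, ← mul_assoc _ w, hw, one_mul, hvw]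
  have hv2 : star v * (w * w) = 0 := by rw [← mul_assoc, hvw, zero_mul]
  have hsplit : w * v * star (w * v) + w * w * star (w * w) = w * star w := by
    rw [star_mul, star_mul]
    calc _ = w * (v * star v + w * star w) * star w := by noncomm_ring
      _ = _ := by rw [hsum, mul_one]
  have hs1 : IsStarProjection (v * star v + w * star w) := hsum ▸ IsStarProjection.one _
  have hs2 : IsStarProjection (w * v * star (w * v) + w * w * star (w * w)) :=
    hsplit ▸ isStarProjection_mul_star hw
  have hcongr : ∀ {p q : BddOp H} (hp : IsStarProjection p) (hq : IsStarProjection q), p = q →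
      phaseIntegral A hp = phaseIntegral A hq := by
    rintro p _ hp hq rfl; rfl
  have e1 := phaseIntegral_add hc hv hw hvw hs1
  have e2 := phaseIntegral_add hc hwv hww horth hs2
  have e3 := phaseIntegral_eq hc hv hw hvw
  have e4 := phaseIntegral_eq hc hv hww hv2
  have e5 := hcongr hs2 (isStarProjection_mul_star hw) hsplit
  have e6 : phaseIntegral A hs1 = 2 * Real.pi := by
    rw [← hA.loopIntegral_scalar]
    refine congrArg (loopIntegral A) (funext fun t => ?_)
    ext1
    rw [coe_phaseUnitary, hsum]
    show _ = ((Circle.exp t : Circle) : ℂ) • (1 : BddOp H)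
    module
  have := Real.pi_pos
  linarith

end Curvature

theorem mainTheorem10 (H : Type u) [NormedAddCommGroup H] [InnerProductSpace ℂ H]
    [CompleteSpace H] [TopologicalSpace.SeparableSpace H] (hH : ¬ FiniteDimensional ℂ H) :
    (∀ η : DiffForm 2 (LieU H) (UGroup H), η.IsBiInvariant → ∀ g, η.val g = 0) ∧
    (∀ η : DiffForm 2 (LiePU H) (PUGroup H), η.IsBiInvariant → ∀ g, η.val g = 0) ∧
    (∀ η : DiffForm 2 (LieUModUK H) (UModUK H), η.IsBiInvariant → ∀ g, η.val g = 0) ∧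
    (∀ A : DiffForm 1 (LieU H) (UGroup H), IsConnection A →
      ∀ F : DiffForm 2 (LiePU H) (PUGroup H), IsCurvature A F → ¬ F.IsPrimitive) := by
  refine ⟨(unitaryExp (BddOp H)).biInvariant_two_form_eq_zero hH,
    (projectiveExp (BddOp H)).biInvariant_two_form_eq_zero hH,
    (calkinExp H).biInvariant_two_form_eq_zero hH, fun A hA F hF hprim => ?_⟩
  have hF0 := (projectiveExp (BddOp H)).biInvariant_two_form_eq_zero hH F hprim.isBiInvariant
  refine hA.not_closed hH fun u => ?_
  rw [← hF u, DiffForm.pullback]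
  rw [show F.val (u : PUGroup H) = 0 from hF0 _]
  rfl
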